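/- Let $K$ be a field, let $n \ge 0$, and let $A = K[x_1,\dots,x_n]$ be the polynomial ring with each $\deg x_i = 1$. For a homogeneous ideal $I$ of $A$ let $H_{A/I}(q)=\dim_K (A/I)_q$ be the Hilbert function of $A/I$, and let $\operatorname{depth} A/I$ be the maximal length of an $A/I$-regular sequence contained in $(x_1,\dots,x_n)$ (for $I\neq A$). For integers $a \ge 0$, $q \ge 1$ write $a = \binom{k_q}{q} + \binom{k_{q-1}}{q-1} + \cdots + \binom{k_1}{1}$ with $k_q > \cdots > k_1 \ge 0$ (such a representation exists and is unique) and put $a^{\langle q\rangle} = \binom{k_q+1}{q+1} + \cdots + \binom{k_1+1}{2}$. Let $H:\mathbb N\to\mathbb N$ satisfy Macaulay's conditions: $H(0)=1$, $H(1)\le n$, and $H(q+1)\le H(q)^{\langle q\rangle}$ for all $q\ge 1$. Let $\mathcal A_H$ be the set of integers $0\le r\le n$ such that there is a homogeneous ideal $I$ of $A$ with $H_{A/I}=H$ and $\operatorname{depth} A/I=r$. A monomial ideal $I$ of $A$ is *lexsegment* if, whenever $u\in I$ and $v$ are monomials of the same degree and $v>_{\mathrm{lex}}u$ (lexicographic order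 with $x_1>\cdots>x_n$), one has $v\in I$. It is *universal lexsegment* if it is lexsegment and, for every $m\ge 1$, its extension to $K[x_1,\dots,x_{n+m}]$ is lexsegment. The function $H$ is *critical* if the unique lexsegment ideal $I$ of $A$ with $H_{A/I}=H$ is universal lexsegment, and *noncritical* otherwise. **Theorem.** (1) If $H$ is noncritical, then $\mathcal A_H$ has a largest element $b$, and $\mathcal A_H=\{0,1,\dots,b\}$. (2) For every $H$ satisfying Macaulay's conditions, critical or not, either $\mathcal A_H=\{0,1,\dots,b\}$ for some $0\le b\le n$, or $|\mathcal A_H|=1$. -/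

import Mathlib

open MvPolynomial

/-- `macaulayPow a d` is the number `a^{⟨d⟩}` of Macaulay's theorem: if
`a = C(k_d, d) + C(k_{d-1}, d-1) + ⋯ + C(k_1, 1)` with `k_d > k_{d-1} > ⋯ > k_1 ≥ 0`
is the `d`-th Macaulay representation of `a` (`d ≥ 1`), then
`a^{⟨d⟩} = C(k_d + 1, d + 1) + ⋯ + C(k_1 + 1, 2)`.
The representation is computed greedily: `k_d` is the largest `k` with `C(k, d) ≤ a`
(such a `k` is at most `a + d - 1`), and one continues with `a - C(k_d, d)`.
See `exists_macaulay_rep` and `macaulayPow_eq` for the agreement with the description above. -/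
def macaulayPow : ℕ → ℕ → ℕ
  | _, 0 => 0
  | a, d + 1 =>
      (Nat.findGreatest (fun k => k.choose (d + 1) ≤ a) (a + d) + 1).choose (d + 2)
        + macaulayPow
            (a - (Nat.findGreatest (fun k => k.choose (d + 1) ≤ a) (a + d)).choose (d + 1)) d

theorem sub_le_choose (k d : ℕ) (hd : 1 ≤ d) : k + 1 - d ≤ k.choose d := by
  induction k with
  | zero => omega
  | succ k ih =>
    obtain ⟨e, rfl⟩ : ∃ e, d = e + 1 := ⟨d - 1, by omega⟩
    rw [Nat.choose_succ_succ']
    by_cases h : e ≤ k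
    · have := Nat.choose_pos h
      omega
    · omega

theorem macaulay_rep_lt (d : ℕ) (hd : 1 ≤ d) (k : ℕ → ℕ) (hk : StrictMonoOn k (Set.Icc 1 d)) :
    ∑ i ∈ Finset.Icc 1 d, (k i).choose i < (k d + 1).choose d := by
  induction d, hd using Nat.le_induction with
  | base => simp
  | succ d hd ih =>
    have h1 := ih (hk.mono (Set.Icc_subset_Icc_right (by omega)))
    have h2 : k d < k (d + 1) := hk ⟨hd, by omega⟩ ⟨by omega, le_rfl⟩ (by omega)
    rw [Finset.sum_Icc_succ_top (by omega), Nat.choose_succ_succ']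
    have := Nat.choose_le_choose d (show k d + 1 ≤ k (d + 1) from h2)
    omega

/-- The value of `macaulayPow` on any sum given by a Macaulay representation. -/
theorem macaulayPow_eq (d : ℕ) (k : ℕ → ℕ) (hk : StrictMonoOn k (Set.Icc 1 d)) :
    macaulayPow (∑ i ∈ Finset.Icc 1 d, (k i).choose i) d
      = ∑ i ∈ Finset.Icc 1 d, (k i + 1).choose (i + 1) := by
  induction d with
  | zero => simp [macaulayPow]
  | succ d ih =>
    have h1 := macaulay_rep_lt (d + 1) (by omega) k hk
    have hsum := Finset.sum_Icc_succ_top (a := 1) (b := d) (by omega) (fun i => (k i).choose i)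
    have hk' := sub_le_choose (k (d + 1)) (d + 1) (by omega)
    have hg : Nat.findGreatest
        (fun j => j.choose (d + 1) ≤ ∑ i ∈ Finset.Icc 1 (d + 1), (k i).choose i)
        ((∑ i ∈ Finset.Icc 1 (d + 1), (k i).choose i) + d) = k (d + 1) := by
      apply le_antisymm
      · by_contra hlt
        have h3 : 0 < Nat.findGreatest
            (fun j => j.choose (d + 1) ≤ ∑ i ∈ Finset.Icc 1 (d + 1), (k i).choose i)
            ((∑ i ∈ Finset.Icc 1 (d + 1), (k i).choose i) + d) := by omega
        have h4 := (Nat.findGreatest_eq_iff.1 rfl).2.1 h3.ne'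
        have h5 := Nat.choose_le_choose (d + 1) (show k (d + 1) + 1 ≤ _ from not_le.1 hlt)
        omega
      · apply Nat.le_findGreatest
        · omega
        · omega
    rw [macaulayPow, hg, hsum, Nat.add_sub_cancel,
      ih (hk.mono (Set.Icc_subset_Icc_right (by omega))), Finset.sum_Icc_succ_top (by omega),
      add_comm]

/-- Macaulay representations exist. -/
theorem exists_macaulay_rep (d : ℕ) (hd : 1 ≤ d) (a : ℕ) :
    ∃ k : ℕ → ℕ, StrictMonoOn k (Set.Icc 1 d) ∧ a = ∑ i ∈ Finset.Icc 1 d, (k i).choose i := by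
  induction d, hd using Nat.le_induction generalizing a with
  | base => exact ⟨fun _ => a, by intro x hx y hy h; simp at hx hy; omega, by simp⟩
  | succ d hd ih =>
    obtain ⟨m, hm⟩ : ∃ m, m = Nat.findGreatest (fun k => k.choose (d + 1) ≤ a) (a + d) := ⟨_, rfl⟩
    have hm1 : m.choose (d + 1) ≤ a := by
      rw [hm]
      exact Nat.findGreatest_spec (P := fun k => k.choose (d + 1) ≤ a) (m := 0) (by omega)
        (by simp)
    have hm2 : a < (m + 1).choose (d + 1) := by
      by_cases h : m + 1 ≤ a + d
      · exact not_le.1 (Nat.findGreatest_is_greatest (P := fun k => k.choose (d + 1) ≤ a)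
          (by rw [← hm]; omega) h)
      · have := sub_le_choose (m + 1) (d + 1) (by omega)
        omega
    obtain ⟨k, hk, hs⟩ := ih (a - m.choose (d + 1))
    have hlt : k d < m := by
      by_contra hge
      have h1 : (k d).choose d ≤ ∑ i ∈ Finset.Icc 1 d, (k i).choose i :=
        Finset.single_le_sum (f := fun i => (k i).choose i) (fun _ _ => Nat.zero_le _)
          (Finset.mem_Icc.2 ⟨hd, le_rfl⟩)
      have h2 := Nat.choose_le_choose d (not_lt.1 hge)
      rw [Nat.choose_succ_succ'] at hm2
      omega
    refine ⟨fun i => if i = d + 1 then m else k i, ?_, ?_⟩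
    · intro x hx y hy hxy
      have hx' : x ≠ d + 1 := by have := hy.2; omega
      simp only [hx', if_false]
      split_ifs with h
      · have hxd : x ≤ d := by omega
        exact lt_of_le_of_lt (hk.monotoneOn ⟨hx.1, hxd⟩ ⟨hd, le_rfl⟩ hxd) hlt
      · exact hk ⟨hx.1, by have := hx.2; omega⟩ ⟨hy.1, by have := hy.2; omega⟩ hxy
    · rw [Finset.sum_Icc_succ_top (by omega)]
      have : ∑ i ∈ Finset.Icc 1 d, (if i = d + 1 then m else k i).choose i
          = ∑ i ∈ Finset.Icc 1 d, (k i).choose i := by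
        refine Finset.sum_congr rfl fun i hi => ?_
        rw [if_neg (by have := (Finset.mem_Icc.1 hi).2; omega)]
      rw [this, ← hs]
      simp only [if_true]
      omega

/-- Macaulay's conditions on a numerical function, for quotients of a polynomial ring
in `n` variables. -/
structure MacaulayConditions (n : ℕ) (H : ℕ → ℕ) : Prop where
  zero : H 0 = 1
  one : H 1 ≤ n
  succ : ∀ q, 1 ≤ q → H (q + 1) ≤ macaulayPow (H q) q

section

attribute [local instance] MvPolynomial.gradedAlgebra

/-- `I` is homogeneous for the standard grading of `K[x_1, …, x_n]`. -/
def IsHomogeneousIdeal {K : Type*} [Field K] {n : ℕ} (I : Ideal (MvPolynomial (Fin n) K)) :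
    Prop :=
  I.IsHomogeneous (homogeneousSubmodule (Fin n) K)

end

/-- The Hilbert function of `A / I`: the dimension over `K` of the image in `A / I` of the
homogeneous polynomials of degree `q`. -/
noncomputable def hilbertFunction {K : Type*} [Field K] {n : ℕ}
    (I : Ideal (MvPolynomial (Fin n) K)) (q : ℕ) : ℕ :=
  Module.finrank K
    ((homogeneousSubmodule (Fin n) K q).map (Ideal.Quotient.mkₐ K I).toLinearMap)

/-- The depth of the `A`-module `A / I`: the supremum of the lengths of the `A / I`-regular
sequences consisting of elements of the graded maximal ideal `(x_1, …, x_n)`. -/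
noncomputable def quotientDepth {K : Type*} [Field K] {n : ℕ}
    (I : Ideal (MvPolynomial (Fin n) K)) : ℕ∞ :=
  ⨆ (rs : List (MvPolynomial (Fin n) K))
    (_ : (∀ f ∈ rs, f ∈ Ideal.span (Set.range (X : Fin n → MvPolynomial (Fin n) K))) ∧
      RingTheory.Sequence.IsRegular (MvPolynomial (Fin n) K ⧸ I) rs), (rs.length : ℕ∞)

/-- `I` is generated by monomials. -/
def IsMonomialIdeal {K : Type*} [Field K] {n : ℕ} (I : Ideal (MvPolynomial (Fin n) K)) : Prop :=
  ∃ S : Set (Fin n →₀ ℕ), I = Ideal.span ((fun u => monomial u (1 : K)) '' S)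

/-- `I` is a lexsegment ideal, for the lexicographic order with `x_1 > x_2 > ⋯ > x_n`. -/
def IsLexsegment {K : Type*} [Field K] {n : ℕ} (I : Ideal (MvPolynomial (Fin n) K)) : Prop :=
  IsMonomialIdeal I ∧
    ∀ u v : Fin n →₀ ℕ, monomial u (1 : K) ∈ I → v.degree = u.degree → toLex u < toLex v →
      monomial v (1 : K) ∈ I

/-- `I` is a lexsegment ideal and its extension to `K[x_1, …, x_{n+m}]` is lexsegment
for every `m ≥ 1`. -/
def IsUniversalLexsegment {K : Type*} [Field K] {n : ℕ} (I : Ideal (MvPolynomial (Fin n) K)) :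
    Prop :=
  IsLexsegment I ∧
    ∀ m : ℕ, 1 ≤ m →
      IsLexsegment (I.map (rename (Fin.castAdd m) :
        MvPolynomial (Fin n) K →ₐ[K] MvPolynomial (Fin (n + m)) K))

/-- `H` is critical: the lexsegment ideal `I` of `K[x_1, …, x_n]` with `H_{A/I} = H`
is universal lexsegment. -/
def IsCritical (K : Type*) [Field K] (n : ℕ) (H : ℕ → ℕ) : Prop :=
  ∃ I : Ideal (MvPolynomial (Fin n) K),
    IsLexsegment I ∧ hilbertFunction I = H ∧ IsUniversalLexsegment I

/-- The set `𝒜_H` of the integers `0 ≤ r ≤ n` that are the depth of `A / I` for some homogeneous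
ideal `I` of `A = K[x_1, …, x_n]` with Hilbert function `H_{A/I} = H`. -/
def depthSet (K : Type*) [Field K] (n : ℕ) (H : ℕ → ℕ) : Set ℕ :=
  {r | r ≤ n ∧ ∃ I : Ideal (MvPolynomial (Fin n) K),
    IsHomogeneousIdeal I ∧ hilbertFunction I = H ∧ quotientDepth I = r}

/-! If `A/I` has depth at least s and the field is infinite, s successive linear forms can be taken
regular. Dividing by such a form replaces the Hilbert function by its first difference, so H is the
s-fold partial sum of a function G satisfying Macaulay's conditions in n - s variables. Conversely,
let S be the lexsegment in n - s variables whose complement is counted by G. Extended to n variables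
it has Hilbert function H, and the s new variables form a regular sequence. By
`LexBelow.determinedBelow_or_exists_socle` there are two cases. Either the quotient in n - s
variables has a socle and the depth is exactly s, or S does not involve its last variable. In the
second case S remains lexsegment after adding any variables, so H is critical. For noncritical H the
depth set is therefore closed downwards, and s = 0 shows that it is nonempty.

For critical H the depth is forced (`LexAll.exists_depthGE_iff`). Let S be the universal lexsegment.
If S omits its last variable, its counting function meets the bound of Green's hyperplane
restriction theorem in every degree. Every ideal with that Hilbert function then has positive depth
(`noSocle_of_greenPow_add_le`); cutting by a regular linear form removes one variable, and induction
applies. If S involves its last variable, H is not the sum transform of any function with Macaulay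
growth (`LexAll.not_sum_transform`), so every such ideal has depth 0.

Green's theorem (`generic_codim_le_greenPow`) rests on the numerical inequality
`greenPow_add_greenPow_lt`, and Macaulay's bound is deduced from it. Rees's exchange argument makes
depth computable from any regular element. Extension to the algebraic closure preserves Hilbert
function and depth, which removes the assumption that the field is infinite. -/

/-! ### The operators of Macaulay and Green on integers -/

/-- The largest `k` with `C(k, d + 1) ≤ a`. -/
theorem exists_choose_le_lt (a d : ℕ) :
    ∃ k, d ≤ k ∧ k.choose (d + 1) ≤ a ∧ a < (k + 1).choose (d + 1) ∧
      Nat.findGreatest (fun k => k.choose (d + 1) ≤ a) (a + d) = k := by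
  refine ⟨_, ?_, ?_, ?_, rfl⟩
  · exact Nat.le_findGreatest (by omega) (by simp)
  · exact Nat.findGreatest_spec (P := fun k => k.choose (d + 1) ≤ a) (m := 0) (by omega) (by simp)
  · by_cases h : Nat.findGreatest (fun k => k.choose (d + 1) ≤ a) (a + d) + 1 ≤ a + d
    · exact not_le.1 (Nat.findGreatest_is_greatest (P := fun k => k.choose (d + 1) ≤ a)
        (Nat.lt_succ_self _) h)
    · have := sub_le_choose (Nat.findGreatest (fun k => k.choose (d + 1) ≤ a) (a + d) + 1)
        (d + 1) (by omega)
      omega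

theorem greedy_unique {a d j k : ℕ} (h1 : j.choose d ≤ a) (h2 : a < (k + 1).choose d) : j ≤ k := by
  by_contra h
  have := Nat.choose_le_choose d (show k + 1 ≤ j by omega)
  omega

/-- The decomposition `a = C(k, d + 1) + b` with `b < C(k, d)`. -/
theorem exists_choose_add (a d : ℕ) : ∃ k b, d ≤ k ∧ b < k.choose d ∧ a = k.choose (d + 1) + b := by
  obtain ⟨k, h0, h1, h2, -⟩ := exists_choose_le_lt a d
  refine ⟨k, a - k.choose (d + 1), h0, ?_, by omega⟩
  rw [Nat.choose_succ_succ'] at h2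
  omega

theorem findGreatest_choose {k d b : ℕ} (hb : b < k.choose d) :
    Nat.findGreatest (fun j => j.choose (d + 1) ≤ k.choose (d + 1) + b)
      (k.choose (d + 1) + b + d) = k := by
  obtain ⟨j, -, h1, h2, h3⟩ := exists_choose_le_lt (k.choose (d + 1) + b) d
  rw [h3]
  refine le_antisymm (greedy_unique h1 ?_) (greedy_unique (by omega) h2)
  rw [Nat.choose_succ_succ']
  omega

theorem macaulayPow_add {k d b : ℕ} (hb : b < k.choose d) :
    macaulayPow (k.choose (d + 1) + b) (d + 1) = (k + 1).choose (d + 2) + macaulayPow b d := by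
  rw [macaulayPow, findGreatest_choose hb, Nat.add_sub_cancel_left]

/-- Green's operator `a ↦ a_{⟨d⟩}`: if `a = C(k_d, d) + ⋯ + C(k_1, 1)` is the Macaulay
representation, then `a_{⟨d⟩} = C(k_d - 1, d) + ⋯ + C(k_1 - 1, 1)`. -/
def greenPow : ℕ → ℕ → ℕ
  | a, 0 => a
  | a, d + 1 =>
      (Nat.findGreatest (fun k => k.choose (d + 1) ≤ a) (a + d) - 1).choose (d + 1)
        + greenPow
            (a - (Nat.findGreatest (fun k => k.choose (d + 1) ≤ a) (a + d)).choose (d + 1)) d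

theorem greenPow_add_of_lt {k d b : ℕ} (hb : b < k.choose d) :
    greenPow (k.choose (d + 1) + b) (d + 1) = (k - 1).choose (d + 1) + greenPow b d := by
  rw [greenPow, findGreatest_choose hb, Nat.add_sub_cancel_left]

@[simp] theorem macaulayPow_zero_left (d : ℕ) : macaulayPow 0 d = 0 := by
  induction d with
  | zero => rfl
  | succ d ih =>
    have := macaulayPow_add (k := d) (d := d) (b := 0) (by simp)
    simpa [ih] using this

@[simp] theorem greenPow_zero_left (d : ℕ) : greenPow 0 d = 0 := by
  induction d with
  | zero => rfl
  | succ d ih =>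
    have := greenPow_add_of_lt (k := d) (d := d) (b := 0) (by simp)
    rw [ih, Nat.choose_succ_self, Nat.choose_eq_zero_of_lt (by omega)] at this
    exact this

theorem macaulayPow_choose {k d : ℕ} (hd : 1 ≤ d) (hk : d ≤ k) :
    macaulayPow (k.choose d) d = (k + 1).choose (d + 1) := by
  obtain ⟨d, rfl⟩ : ∃ e, d = e + 1 := ⟨d - 1, by omega⟩
  have := macaulayPow_add (k := k) (d := d) (b := 0) (Nat.choose_pos (by omega))
  simpa using this

theorem greenPow_choose {k d : ℕ} (hd : 1 ≤ d) (hk : d ≤ k) :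
    greenPow (k.choose d) d = (k - 1).choose d := by
  obtain ⟨d, rfl⟩ : ∃ e, d = e + 1 := ⟨d - 1, by omega⟩
  have := greenPow_add_of_lt (k := k) (d := d) (b := 0) (Nat.choose_pos (by omega))
  simpa using this

/-- By Pascal's rule the recursion survives the boundary value b = C(k, d), where the decomposition
is no longer the greedy one. Later estimates can then ignore whether adding 1 changes the leading
term. -/
theorem greenPow_add {k d b : ℕ} (h1 : 1 ≤ k) (hk : d ≤ k) (hb : b ≤ k.choose d) :
    greenPow (k.choose (d + 1) + b) (d + 1) = (k - 1).choose (d + 1) + greenPow b d := by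
  rcases hb.lt_or_eq with h | rfl
  · exact greenPow_add_of_lt h
  · obtain ⟨k, rfl⟩ : ∃ e, k = e + 1 := ⟨k - 1, by omega⟩
    rw [add_comm, ← Nat.choose_succ_succ', greenPow_choose (by omega) (by omega),
      Nat.add_sub_cancel, Nat.add_sub_cancel]
    rcases Nat.eq_zero_or_pos d with rfl | hd
    · simp [greenPow]
    · rw [greenPow_choose hd hk, Nat.add_sub_cancel]
      obtain ⟨d, rfl⟩ : ∃ e, d = e + 1 := ⟨d - 1, by omega⟩
      rw [Nat.choose_succ_succ' k (d + 1), add_comm]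

/-- The two claims are proved together. The bound for d gives strict growth for d + 1 where the
leading binomial jumps, and strict growth for d + 1 gives the bound for d + 1 by comparison with
C(k, d + 1). -/
theorem macaulayPow_lt_choose_and_lt_succ (d : ℕ) :
    (∀ k b, b < k.choose d → macaulayPow b d < (k + 1).choose (d + 1)) ∧
    (1 ≤ d → ∀ a, macaulayPow a d < macaulayPow (a + 1) d) := by
  induction d with
  | zero => simp [macaulayPow]
  | succ d ih =>
    have step : ∀ a, macaulayPow a (d + 1) < macaulayPow (a + 1) (d + 1) := by
      intro a
      obtain ⟨k, b, hk, hb, rfl⟩ := exists_choose_add a d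
      rw [macaulayPow_add hb]
      by_cases h : b + 1 < k.choose d
      · rw [add_assoc, macaulayPow_add h]
        rcases Nat.eq_zero_or_pos d with rfl | hd
        · simp at h
        · have := ih.2 hd b
          omega
      · have e : k.choose (d + 1) + b + 1 = (k + 1).choose (d + 1) := by
          rw [Nat.choose_succ_succ']; omega
        rw [e, macaulayPow_choose (by omega) (by omega), Nat.choose_succ_succ' (k + 1) (d + 1)]
        rw [show d + 1 + 1 = d + 2 from rfl]
        have := ih.1 k b hb
        omega
    refine ⟨fun k b hb => ?_, fun _ => step⟩
    have hk : d + 1 ≤ k := by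
      by_contra h
      rw [Nat.choose_eq_zero_of_lt (by omega)] at hb
      omega
    rw [← macaulayPow_choose (by omega) hk]
    exact strictMono_nat_of_lt_succ step hb

theorem macaulayPow_lt_choose {d k b : ℕ} (hb : b < k.choose d) :
    macaulayPow b d < (k + 1).choose (d + 1) :=
  (macaulayPow_lt_choose_and_lt_succ d).1 k b hb

theorem macaulayPow_strictMono {d : ℕ} (hd : 1 ≤ d) : StrictMono fun a => macaulayPow a d :=
  strictMono_nat_of_lt_succ ((macaulayPow_lt_choose_and_lt_succ d).2 hd)

theorem macaulayPow_mono {d a b : ℕ} (h : a ≤ b) : macaulayPow a d ≤ macaulayPow b d := by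
  rcases Nat.eq_zero_or_pos d with rfl | hd
  · simp [macaulayPow]
  · exact (macaulayPow_strictMono hd).monotone h

/-- Green's operator is monotone and increases by at most 1 per step. This Lipschitz property is
what transfers exact identities at special values to inequalities at all larger values. -/
theorem greenPow_succ_bounds (a d : ℕ) :
    greenPow a d ≤ greenPow (a + 1) d ∧ greenPow (a + 1) d ≤ greenPow a d + 1 := by
  induction d generalizing a with
  | zero => simp [greenPow]
  | succ d ih =>
    obtain ⟨k, b, hk, hb, rfl⟩ := exists_choose_add a d
    rcases Nat.eq_zero_or_pos k with rfl | h1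
    · obtain rfl : d = 0 := by omega
      obtain rfl : b = 0 := by simpa using hb
      have := greenPow_choose (k := 1) (d := 1) le_rfl le_rfl
      simp at this
      simp [this]
    · rw [greenPow_add h1 hk hb.le, add_assoc,
        greenPow_add h1 hk (show b + 1 ≤ k.choose d from hb)]
      have := ih b
      omega

theorem greenPow_mono {d a b : ℕ} (h : a ≤ b) : greenPow a d ≤ greenPow b d :=
  monotone_nat_of_le_succ (f := fun a => greenPow a d) (fun a => (greenPow_succ_bounds a d).1) h

theorem greenPow_add_le (a c d : ℕ) : greenPow (a + c) d ≤ greenPow a d + c := by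
  induction c with
  | zero => simp
  | succ c ih =>
    have := (greenPow_succ_bounds (a + c) d).2
    rw [← add_assoc]
    omega

theorem greenPow_le (a d : ℕ) : greenPow a d ≤ a := by
  simpa using greenPow_add_le 0 a d

/-- Guarantees that the remainder stays admissible, so the decomposition of the Green transform of a
is obtained from that of a by lowering the leading entry. The condition d < k is needed: for k = d ≥
1 the claim would read 0 < 0. -/
theorem greenPow_lt_choose {d k b : ℕ} (hk : d < k) (hb : b < k.choose d) :
    greenPow b d < (k - 1).choose d := by
  induction d generalizing k b with
  | zero => simpa [greenPow] using hb
  | succ d ih =>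
    induction k, hk using Nat.le_induction generalizing b with
    | base =>
      rw [Nat.choose_succ_self_right] at hb
      rw [Nat.succ_eq_add_one, Nat.add_sub_cancel, Nat.choose_self, Nat.lt_one_iff]
      obtain ⟨j, c, hj, hc, rfl⟩ := exists_choose_add b d
      have hjd : j ≤ d + 1 := by
        refine greedy_unique (d := d + 1) (a := d + 1) (by omega) ?_
        rw [Nat.choose_succ_self_right]
        omega
      rcases Nat.lt_or_ge d j with h | h
      · have hj' : j = d + 1 := by omega
        subst hj'
        have := ih (k := d + 1) (by omega) hc
        rw [greenPow_add_of_lt hc]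
        simp at this ⊢
        exact this
      · have hj' : j = d := by omega
        subst hj'
        have : c = 0 := by simpa using hc
        simp [this]
    | succ k hk ih2 =>
      simp only [Nat.add_sub_cancel]
      rcases Nat.lt_or_ge b (k.choose (d + 1)) with h | h
      · exact (ih2 h).trans_le (Nat.choose_le_choose _ (by omega))
      · obtain ⟨c, rfl⟩ := Nat.exists_eq_add_of_le h
        have hc : c < k.choose d := by
          rw [Nat.choose_succ_succ'] at hb; omega
        rw [greenPow_add_of_lt hc]
        have := ih (k := k) (by omega) hc
        obtain ⟨k, rfl⟩ : ∃ e, k = e + 1 := ⟨k - 1, by omega⟩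
        rw [Nat.choose_succ_succ' k d]
        simp only [Nat.add_sub_cancel] at this ⊢
        omega

/-- Pascal's rule term by term. One step above the Macaulay bound, the drop under Green's operator
is already larger than b, which is how Green's theorem implies Macaulay's. -/
theorem greenPow_macaulayPow_succ_add_le {q b : ℕ} (h : q = 0 → b = 0) :
    greenPow (macaulayPow b q + 1) (q + 1) + b ≤ macaulayPow b q := by
  induction q generalizing b with
  | zero =>
    obtain rfl := h rfl
    have := greenPow_choose (k := 1) (d := 1) le_rfl le_rfl
    simp at this
    simp [this]
  | succ q ih =>
    obtain ⟨k, c, hk, hc, rfl⟩ := exists_choose_add b q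
    rw [macaulayPow_add hc, add_assoc,
      greenPow_add (by omega) (by omega)
        (show macaulayPow c q + 1 ≤ (k + 1).choose (q + 1) from macaulayPow_lt_choose hc),
      Nat.add_sub_cancel]
    have := ih (b := c) (by rintro rfl; simpa using hc)
    rw [Nat.choose_succ_succ' k (q + 1)]
    omega

/-- At the Macaulay bound itself the drop is at most b. This is Pascal's rule C(k + 1, q + 1) = C(k,
q + 1) + C(k, q) applied to each term. -/
theorem macaulayPow_le_greenPow_add (q b : ℕ) :
    macaulayPow b q ≤ greenPow (macaulayPow b q) (q + 1) + b := by
  induction q generalizing b with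
  | zero => simp [macaulayPow]
  | succ q ih =>
    obtain ⟨k, c, hk, hc, rfl⟩ := exists_choose_add b q
    rw [macaulayPow_add hc,
      greenPow_add (by omega) (by omega) (macaulayPow_lt_choose hc).le, Nat.add_sub_cancel]
    have := ih c
    rw [Nat.choose_succ_succ' k (q + 1)]
    omega

/-- Again Pascal's rule, with C(k, d + 1) + C(k, d) = C(k + 1, d + 1) in each term. It says that the
sum transform cannot reach maximal growth once its differences fall below Green's value. -/
theorem macaulayPow_greenPow_add_le {d : ℕ} (hd : 1 ≤ d) (a : ℕ) :
    macaulayPow (greenPow a d) d + a ≤ macaulayPow a d := by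
  obtain ⟨d, rfl⟩ : ∃ e, d = e + 1 := ⟨d - 1, by omega⟩
  clear hd
  induction d generalizing a with
  | zero =>
    obtain ⟨k, c, hk, hc, rfl⟩ := exists_choose_add a 0
    obtain rfl : c = 0 := by simpa using hc
    rcases Nat.eq_zero_or_pos k with rfl | h1
    · simp
    · rw [greenPow_add_of_lt hc, macaulayPow_add hc]
      have := macaulayPow_add (k := k - 1) (d := 0) (b := 0) (by simp)
      simp only [zero_add] at this ⊢
      rw [greenPow_zero_left, this, Nat.sub_add_cancel h1, Nat.choose_succ_succ' k 1]
      simp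
      omega
  | succ d ih =>
    obtain ⟨k, c, hk, hc, rfl⟩ := exists_choose_add a (d + 1)
    rcases hk.eq_or_lt with rfl | hk
    · obtain rfl : c = 0 := by simpa using hc
      simp
    · rw [greenPow_add_of_lt hc, macaulayPow_add hc, macaulayPow_add (greenPow_lt_choose hk hc),
        Nat.sub_add_cancel (by omega), Nat.choose_succ_succ' k (d + 1 + 1)]
      have := ih c
      rw [show d + 1 + 1 = d + 2 from rfl, show d + 1 + 2 = d + 2 + 1 from rfl] at *
      omega

/-- The numerical inequality behind Green's theorem. -/
theorem greenPow_add_greenPow_lt {d a c : ℕ} (h1 : greenPow a (d + 1) < c) (h2 : c ≤ a) :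
    greenPow c (d + 1) + greenPow (a - c) d < c := by
  induction d generalizing a c with
  | zero =>
    obtain ⟨k, b, hk, hb, rfl⟩ := exists_choose_add a 0
    have hb0 : b = 0 := by simpa using hb
    subst hb0
    rw [greenPow_add_of_lt hb] at h1
    simp only [zero_add, Nat.choose_one_right, greenPow_zero_left, add_zero] at h1 h2
    obtain rfl : c = k := by omega
    have h3 := greenPow_add_of_lt (k := c) (d := 0) hb
    simp only [zero_add, Nat.choose_one_right, greenPow_zero_left, add_zero] at h3
    simp [h3]
    omega
  | succ d ih =>
    -- The smallest admissible c suffices: raising c by e raises the right side by e, the first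
    -- summand by at most e, and does not raise the second.
    suffices hs : greenPow (greenPow a (d + 2) + 1) (d + 2)
        + greenPow (a - (greenPow a (d + 2) + 1)) (d + 1) < greenPow a (d + 2) + 1 by
      obtain ⟨e, rfl⟩ := Nat.exists_eq_add_of_le (show greenPow a (d + 2) + 1 ≤ c from h1)
      have h3 := greenPow_add_le (greenPow a (d + 2) + 1) e (d + 2)
      have h4 := greenPow_mono (d := d + 1)
        (show a - (greenPow a (d + 2) + 1 + e) ≤ a - (greenPow a (d + 2) + 1) by omega)
      change greenPow _ (d + 2) + _ < _
      omega
    have ha : greenPow a (d + 2) + 1 ≤ a := by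
      have : greenPow a (d + 1 + 1) = greenPow a (d + 2) := rfl
      omega
    clear h1 h2
    obtain ⟨k, b, hk, hb, rfl⟩ := exists_choose_add a (d + 1)
    rcases hk.eq_or_lt with rfl | hk
    · obtain rfl : b = 0 := by simpa using hb
      simp at ha
    · rw [show d + 2 = d + 1 + 1 from rfl] at *
      rw [greenPow_add_of_lt hb] at *
      have h3 := greenPow_lt_choose hk hb
      rw [add_assoc] at *
      obtain ⟨k, rfl⟩ : ∃ e, k = e + 1 := ⟨k - 1, by omega⟩
      simp only [Nat.add_sub_cancel] at *
      rw [greenPow_add (by omega) (by omega)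
        (show greenPow b (d + 1) + 1 ≤ k.choose (d + 1) from h3)]
      obtain ⟨j, rfl⟩ : ∃ e, k = e + 1 := ⟨k - 1, by omega⟩
      simp only [Nat.add_sub_cancel] at *
      rw [Nat.choose_succ_succ' (j + 1) (d + 1)]
      -- For b = 0 the induction hypothesis is not available, since its c would be 1 > b.
      rcases Nat.eq_zero_or_pos b with rfl | hb0
      · have h5 : greenPow 1 (d + 1) = 0 := by
          have := greenPow_choose (k := d + 1) (d := d + 1) (by omega) le_rfl
          simpa using this
        have h6 : greenPow ((j + 1).choose (d + 1)) (d + 1) = j.choose (d + 1) :=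
          greenPow_choose (by omega) (by omega)
        have h7 := greenPow_mono (d := d + 1)
          (show (j + 1).choose (d + 1) + (j + 1).choose (d + 1 + 1) + 0
            - ((j + 1).choose (d + 1 + 1) + (greenPow 0 (d + 1) + 1)) ≤ (j + 1).choose (d + 1)
            by omega)
        rw [h6] at h7
        simp only [greenPow_zero_left, zero_add] at *
        have h8 := Nat.choose_succ_succ' j (d + 1)
        rw [h5]
        omega
      · have h4 : greenPow b (d + 1) + 1 ≤ b := by
          obtain ⟨e, rfl⟩ : ∃ e, b = 1 + e := ⟨b - 1, by omega⟩
          have h5 : greenPow 1 (d + 1) = 0 := by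
            have := greenPow_choose (k := d + 1) (d := d + 1) (by omega) le_rfl
            simpa using this
          have := greenPow_add_le 1 e (d + 1)
          omega
        have h8 := ih (a := b) (c := greenPow b (d + 1) + 1) (by omega) h4
        have e1 : (j + 1).choose (d + 1) + (j + 1).choose (d + 1 + 1) + b
            - ((j + 1).choose (d + 1 + 1) + (greenPow b (d + 1) + 1))
            = (j + 1).choose (d + 1) + (b - (greenPow b (d + 1) + 1)) := by omega
        -- The Lipschitz property between b and C(j + 2, d + 1) bounds the drop of b by the drop of
        -- that binomial, which is C(j + 1, d).
        have h9 : b - (greenPow b (d + 1) + 1) ≤ (j + 1).choose d := by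
          have h10 := greenPow_add_le b ((j + 1 + 1).choose (d + 1) - b) (d + 1)
          rw [Nat.add_sub_cancel' hb.le, greenPow_choose (by omega) (by omega),
            Nat.choose_succ_succ' (j + 1) d] at h10
          rw [Nat.choose_succ_succ' (j + 1) d] at hb
          simp only [Nat.add_sub_cancel] at h10
          omega
        have h11 := Nat.choose_succ_succ' j (d + 1)
        rw [e1, greenPow_add (by omega) (by omega) h9]
        simp only [Nat.add_sub_cancel]
        omega

/-! ### Lexicographic ranks and lexsegments of exponents -/

/-- The exponents of degree `q` supported in `{0, …, m - 1}`. -/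
noncomputable def mons (m q : ℕ) : Finset (ℕ →₀ ℕ) := (Finset.range m).finsuppAntidiag q

theorem sum_eq_degree {s : Finset ℕ} {u : ℕ →₀ ℕ} (h : u.support ⊆ s) : s.sum u = u.degree := by
  rw [Finsupp.degree_apply]
  exact (Finset.sum_subset h fun x _ hx => by simpa using hx).symm

theorem mem_finsuppAntidiag_iff_degree {s : Finset ℕ} {q : ℕ} {u : ℕ →₀ ℕ} :
    u ∈ s.finsuppAntidiag q ↔ u.degree = q ∧ ∀ j, j ∉ s → u j = 0 := by
  rw [Finset.mem_finsuppAntidiag]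
  have : u.support ⊆ s ↔ ∀ j, j ∉ s → u j = 0 := by
    simp only [Finset.subset_iff, Finsupp.mem_support_iff]
    exact forall_congr' fun j => not_imp_comm
  rw [← this]
  constructor
  · rintro ⟨h, h'⟩
    exact ⟨by rw [← h, sum_eq_degree h'], h'⟩
  · rintro ⟨h, h'⟩
    exact ⟨by rw [← h, sum_eq_degree h'], h'⟩

theorem mem_mons {m q : ℕ} {u : ℕ →₀ ℕ} : u ∈ mons m q ↔ u.degree = q ∧ ∀ j, m ≤ j → u j = 0 := by
  rw [mons, mem_finsuppAntidiag_iff_degree]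
  simp

theorem card_mons (m q : ℕ) : (mons m q).card = (m + q - 1).choose q := by
  rw [mons, Finset.card_finsuppAntidiag_nat_eq_choose, Finset.card_range]

open Classical in
/-- The number of exponents below `m` of the same degree that are lexicographically smaller. -/
noncomputable def lexRank (m : ℕ) (v : ℕ →₀ ℕ) : ℕ :=
  ((mons m v.degree).filter fun u => toLex u < toLex v).card

theorem lex_add_single {u v : ℕ →₀ ℕ} (i : ℕ) :
    toLex (u + Finsupp.single i 1) < toLex (v + Finsupp.single i 1) ↔ toLex u < toLex v := by
  rw [toLex_add, toLex_add, add_lt_add_iff_right]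

theorem degree_add_single (u : ℕ →₀ ℕ) (i : ℕ) :
    (u + Finsupp.single i 1).degree = u.degree + 1 := by
  simp

theorem exists_eq_add_single {u : ℕ →₀ ℕ} {i : ℕ} (h : u i ≠ 0) :
    ∃ w, u = w + Finsupp.single i 1 :=
  ⟨u - Finsupp.single i 1, (tsub_add_cancel_of_le (by simpa [Nat.one_le_iff_ne_zero] using h)).symm⟩

theorem lexRank_zero (m : ℕ) : lexRank m 0 = 0 := by
  classical
  rw [lexRank, Finset.card_eq_zero, Finset.filter_eq_empty_iff]
  intro u _ h
  obtain ⟨i, -, hi⟩ := Finsupp.Lex.lt_iff.1 h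
  exact absurd hi (by simp)

/-- A monomial below x_i w either avoids x_i and all earlier variables, or is x_i times a monomial
below w. Iterated, this produces the Macaulay representation of the rank. -/
theorem lexRank_add_single {m i : ℕ} (hi : i < m) {w : ℕ →₀ ℕ} (hw : ∀ j, j < i ∨ m ≤ j → w j = 0) :
    lexRank m (w + Finsupp.single i 1)
      = (m - 1 - i + w.degree).choose (w.degree + 1) + lexRank m w := by
  classical
  have key : (mons m (w.degree + 1)).filter (fun u => toLex u < toLex (w + Finsupp.single i 1))
      = (Finset.Ico (i + 1) m).finsuppAntidiag (w.degree + 1) ∪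
        ((mons m w.degree).filter fun u => toLex u < toLex w).image (· + Finsupp.single i 1) := by
    ext u
    simp only [Finset.mem_filter, Finset.mem_union, Finset.mem_image, mem_mons,
      mem_finsuppAntidiag_iff_degree]
    constructor
    · rintro ⟨⟨h1, h2⟩, h3⟩
      by_cases hu : u i = 0
      · left
        refine ⟨h1, fun j hj => ?_⟩
        simp only [Finset.mem_Ico, not_and, not_lt] at hj
        rcases lt_trichotomy j i with h | rfl | h
        · obtain ⟨k, hk1, hk2⟩ := Finsupp.Lex.lt_iff.1 h3
          have hki : ¬ k < i := by
            intro hki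
            simp [hw k (Or.inl hki), Finsupp.single_eq_of_ne hki.ne] at hk2
          have := hk1 j (by omega)
          simpa [hw j (Or.inl h), Finsupp.single_eq_of_ne h.ne] using this
        · exact hu
        · exact h2 j (hj (by omega))
      · obtain ⟨w', rfl⟩ := exists_eq_add_single hu
        right
        refine ⟨w', ⟨⟨by simpa using h1, fun j hj => ?_⟩, (lex_add_single i).1 h3⟩, rfl⟩
        have := h2 j hj
        simp at this
        exact this.1
    · rintro (⟨h1, h2⟩ | ⟨w', ⟨⟨h1, h2⟩, h3⟩, rfl⟩)
      · refine ⟨⟨h1, fun j hj => h2 j (by simp; omega)⟩, Finsupp.Lex.lt_iff.2 ⟨i, fun j hj => ?_, ?_⟩⟩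
        · simp [hw j (Or.inl hj), Finsupp.single_eq_of_ne hj.ne, h2 j (by simp; omega)]
        · simp [h2 i (by simp)]
      · refine ⟨⟨by simpa using h1, fun j hj => ?_⟩, (lex_add_single i).2 h3⟩
        simp [h2 j hj, Finsupp.single_eq_of_ne (show j ≠ i by omega)]
  have hdisj : Disjoint ((Finset.Ico (i + 1) m).finsuppAntidiag (w.degree + 1))
      (((mons m w.degree).filter fun u => toLex u < toLex w).image (· + Finsupp.single i 1)) := by
    rw [Finset.disjoint_left]
    intro u h1 h2
    obtain ⟨w', -, rfl⟩ := Finset.mem_image.1 h2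
    have := (mem_finsuppAntidiag_iff_degree.1 h1).2 i (by simp)
    simp at this
  rw [lexRank, degree_add_single, key, Finset.card_union_of_disjoint hdisj,
    Finset.card_image_of_injective _ (add_left_injective _),
    Finset.card_finsuppAntidiag_nat_eq_choose, Nat.card_Ico, ← lexRank]
  congr 2
  omega

/-- The smaller monomials also avoid the variables before x_i, and w itself is not among them. This
is the admissibility condition that makes the previous decomposition the greedy one. -/
theorem lexRank_lt {m i : ℕ} (hi : i < m) {w : ℕ →₀ ℕ} (hw : ∀ j, j < i ∨ m ≤ j → w j = 0) :
    lexRank m w < (m - 1 - i + w.degree).choose w.degree := by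
  classical
  have hsub : (mons m w.degree).filter (fun u => toLex u < toLex w) ⊂
      (Finset.Ico i m).finsuppAntidiag w.degree := by
    rw [Finset.ssubset_iff_of_subset]
    · refine ⟨w, mem_finsuppAntidiag_iff_degree.2 ⟨rfl, fun j hj => hw j (by simp at hj; omega)⟩, ?_⟩
      simp
    · intro u hu
      simp only [Finset.mem_filter, mem_mons] at hu
      refine mem_finsuppAntidiag_iff_degree.2 ⟨hu.1.1, fun j hj => ?_⟩
      simp only [Finset.mem_Ico, not_and, not_lt] at hj
      rcases Nat.lt_or_ge j i with h | h
      · obtain ⟨k, hk1, hk2⟩ := Finsupp.Lex.lt_iff.1 hu.2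
        have hki : ¬ k < i := by
          intro hki
          simp [hw k (Or.inl hki)] at hk2
        have := hk1 j (by omega)
        simpa [hw j (Or.inl h)] using this
      · exact hu.1.2 j (hj h)
  have := Finset.card_lt_card hsub
  rw [Finset.card_finsuppAntidiag_nat_eq_choose, Nat.card_Ico] at this
  rw [lexRank]
  convert this using 2
  omega

/-- Combinatorial meaning of Macaulay's operator: multiplication by the last variable transforms
ranks by it. Splitting off the first variable that occurs reduces to lower degree, since both ranks
decompose in parallel. -/
theorem lexRank_add_single_last (k : ℕ) {v : ℕ →₀ ℕ} (hv : ∀ j, k + 1 ≤ j → v j = 0) :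
    lexRank (k + 1) (v + Finsupp.single k 1) = macaulayPow (lexRank (k + 1) v) v.degree := by
  generalize hq : v.degree = q
  induction q generalizing v with
  | zero =>
    obtain rfl := (Finsupp.degree_eq_zero_iff v).1 hq
    rw [lexRank_add_single (by omega) (by simp)]
    simp [lexRank_zero]
  | succ q ih =>
    have hne : v.support.Nonempty := by
      rw [Finsupp.support_nonempty_iff]
      rintro rfl
      simp at hq
    obtain ⟨i, hi, hmin⟩ : ∃ i, v i ≠ 0 ∧ ∀ j, j < i → v j = 0 := by
      refine ⟨v.support.min' hne, by simpa using v.support.min'_mem hne, fun j hj => ?_⟩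
      by_contra h
      have := v.support.min'_le j (by simpa using h)
      omega
    have him : i < k + 1 := by
      by_contra h
      exact hi (hv i (by omega))
    obtain ⟨w, rfl⟩ := exists_eq_add_single hi
    have hw : ∀ j, j < i ∨ k + 1 ≤ j → w j = 0 := by
      rintro j (h | h)
      · have := hmin j h
        simp at this
        exact this.1
      · have := hv j h
        simp at this
        exact this.1
    have hwq : w.degree = q := by simpa using hq
    have hw' : ∀ j, j < i ∨ k + 1 ≤ j → (w + Finsupp.single k 1 : ℕ →₀ ℕ) j = 0 := by
      intro j hj
      have := hw j hj
      simp [this, Finsupp.single_eq_of_ne (show j ≠ k by omega)]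
    have hlt := lexRank_lt him hw
    rw [add_right_comm, lexRank_add_single him hw', lexRank_add_single him hw,
      ih (fun j hj => hw j (Or.inr hj)) hwq, degree_add_single, hwq]
    rw [hwq] at hlt
    rw [macaulayPow_add hlt]
    rfl

theorem lexRank_strictMono {m : ℕ} {u v : ℕ →₀ ℕ} (hu : ∀ j, m ≤ j → u j = 0)
    (hd : u.degree = v.degree) (h : toLex u < toLex v) : lexRank m u < lexRank m v := by
  classical
  refine Finset.card_lt_card ((Finset.ssubset_iff_of_subset fun w hw => ?_).2 ⟨u, ?_, ?_⟩)
  · simp only [Finset.mem_filter, hd] at hw ⊢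
    exact ⟨hw.1, hw.2.trans h⟩
  · simpa [mem_mons, hd, h] using hu
  · simp

/-- Distinct monomials of one degree have distinct ranks, so the ranks fill an initial segment of
the integers. -/
theorem card_filter_lexRank_lt {m q a : ℕ} (ha : a ≤ (mons m q).card) :
    ((mons m q).filter fun u => lexRank m u < a).card = a := by
  classical
  have hinj : Set.InjOn (lexRank m) (mons m q : Set (ℕ →₀ ℕ)) := by
    intro u hu v hv h
    have hu' := mem_mons.1 hu
    have hv' := mem_mons.1 hv
    rcases lt_trichotomy (toLex u) (toLex v) with h1 | h1 | h1
    · have := lexRank_strictMono hu'.2 (hu'.1.trans hv'.1.symm) h1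
      omega
    · exact h1
    · have := lexRank_strictMono hv'.2 (hv'.1.trans hu'.1.symm) h1
      omega
  have himg : (mons m q).image (lexRank m) = Finset.range (mons m q).card := by
    refine Finset.eq_of_subset_of_card_le ?_ ?_
    · intro x hx
      obtain ⟨u, hu, rfl⟩ := Finset.mem_image.1 hx
      have hu' := mem_mons.1 hu
      rw [Finset.mem_range, lexRank, hu'.1]
      refine Finset.card_lt_card ((Finset.ssubset_iff_of_subset (Finset.filter_subset _ _)).2
        ⟨u, hu, by simp⟩)
    · rw [Finset.card_image_of_injOn hinj, Finset.card_range]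
  rw [← Finset.card_image_of_injOn (hinj.mono (Finset.coe_subset.2 (Finset.filter_subset _ _)))]
  have : ((mons m q).filter fun u => lexRank m u < a).image (lexRank m) = Finset.range a := by
    ext x
    simp only [Finset.mem_image, Finset.mem_filter, Finset.mem_range]
    constructor
    · rintro ⟨u, ⟨-, h⟩, rfl⟩
      exact h
    · intro hx
      have : x ∈ (mons m q).image (lexRank m) := by
        rw [himg, Finset.mem_range]
        omega
      obtain ⟨u, hu, rfl⟩ := Finset.mem_image.1 this
      exact ⟨u, ⟨hu, hx⟩, rfl⟩
  rw [this, Finset.card_range]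

/-- Membership in `S` depends on the first `m` exponents only. -/
def DeterminedBelow (m : ℕ) (S : Set (ℕ →₀ ℕ)) : Prop :=
  ∀ u, u ∈ S ↔ u.filter (· < m) ∈ S

/-- `S` is a lexsegment in the first `m` variables. -/
def LexBelow (m : ℕ) (S : Set (ℕ →₀ ℕ)) : Prop :=
  ∀ u v : ℕ →₀ ℕ, (∀ j, m ≤ j → u j = 0) → (∀ j, m ≤ j → v j = 0) → v.degree = u.degree →
    u ∈ S → toLex u < toLex v → v ∈ S

/-- `S` is a lexsegment in all variables. -/
def LexAll (S : Set (ℕ →₀ ℕ)) : Prop :=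
  ∀ u v : ℕ →₀ ℕ, v.degree = u.degree → u ∈ S → toLex u < toLex v → v ∈ S

open Classical in
/-- The number of exponents of degree `q` below `m` outside `S`. -/
noncomputable def standardCount (S : Set (ℕ →₀ ℕ)) (m q : ℕ) : ℕ :=
  ((mons m q).filter fun u => u ∉ S).card

theorem MacaulayConditions.le_card_mons {m : ℕ} {G : ℕ → ℕ} (hG : MacaulayConditions m G) (q : ℕ) :
    G q ≤ (mons m q).card := by
  rw [card_mons]
  rcases Nat.eq_zero_or_pos q with rfl | hq
  · simp [hG.zero]
  rcases Nat.eq_zero_or_pos m with rfl | hm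
  · have : ∀ q, 1 ≤ q → G q = 0 := by
      intro q hq
      induction q, hq using Nat.le_induction with
      | base => exact Nat.le_zero.1 hG.one
      | succ q hq ih => simpa [ih] using hG.succ q hq
    rw [this q hq]
    exact Nat.zero_le _
  · induction q, hq using Nat.le_induction with
    | base => simpa using hG.one
    | succ q hq ih =>
      refine (hG.succ q hq).trans ((macaulayPow_mono ih).trans ?_)
      rw [macaulayPow_choose hq (by omega)]
      exact Nat.choose_le_choose _ (by omega)

theorem isUpperSet_of_add_single {S : Set (ℕ →₀ ℕ)}
    (h : ∀ u i, u ∈ S → u + Finsupp.single i 1 ∈ S) : IsUpperSet S := by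
  have key : ∀ w u, u ∈ S → u + w ∈ S := by
    intro w
    induction w using Finsupp.induction_linear with
    | zero => simp
    | add f g hf hg =>
      intro u hu
      rw [← add_assoc]
      exact hg _ (hf _ hu)
    | single i n =>
      induction n with
      | zero => simp
      | succ n ih =>
        intro u hu
        rw [Finsupp.single_add, ← add_assoc]
        exact h _ _ (ih _ hu)
  intro u v huv hu
  have := key (v - u) u hu
  rwa [add_tsub_cancel_of_le huv] at this

theorem filter_lt_eq_self {m : ℕ} {u : ℕ →₀ ℕ} (h : ∀ j, m ≤ j → u j = 0) :
    u.filter (· < m) = u := by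
  rw [Finsupp.filter_eq_self_iff]
  intro j hj
  by_contra h'
  exact hj (h j (by omega))

theorem filter_lt_apply_of_le {m j : ℕ} (u : ℕ →₀ ℕ) (h : m ≤ j) : u.filter (· < m) j = 0 :=
  Finsupp.filter_apply_neg _ _ (by omega)

theorem single_lex_lt {u : ℕ →₀ ℕ} {i k : ℕ} (h : i < k) :
    toLex (u + Finsupp.single k 1) < toLex (u + Finsupp.single i 1) := by
  rw [toLex_add, toLex_add, add_lt_add_iff_left]
  exact Finsupp.Lex.single_lt_iff.2 h

/-- Every function satisfying Macaulay's conditions is the counting function of the complement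
of a lexsegment. -/
theorem MacaulayConditions.exists_lexBelow {m : ℕ} {G : ℕ → ℕ} (hG : MacaulayConditions m G) :
    ∃ S : Set (ℕ →₀ ℕ), IsUpperSet S ∧ DeterminedBelow m S ∧ LexBelow m S ∧
      ∀ q, standardCount S m q = G q := by
  classical
  -- The complement consists, in each degree q, of the G q lexicographically smallest exponents in
  -- the first m variables.
  refine ⟨{u | G (u.filter (· < m)).degree ≤ lexRank m (u.filter (· < m))}, ?_, ?_, ?_, ?_⟩
  · refine isUpperSet_of_add_single fun u i hu => ?_
    simp only [Set.mem_ofPred_eq, Finsupp.filter_add] at hu ⊢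
    have hv : ∀ j, m ≤ j → u.filter (· < m) j = 0 := fun j hj => filter_lt_apply_of_le u hj
    generalize u.filter (· < m) = v at hu hv
    by_cases hi : i < m
    · obtain ⟨k, rfl⟩ : ∃ k, m = k + 1 := ⟨m - 1, by omega⟩
      rw [Finsupp.filter_single_of_pos (fun x => x < k + 1) hi, degree_add_single]
      have h0 : 1 ≤ v.degree := by
        by_contra h
        have : v = 0 := (Finsupp.degree_eq_zero_iff v).1 (by omega)
        subst this
        simp [hG.zero, lexRank_zero] at hu
      -- Multiplying by the last variable gives the smallest product, and its rank is the Macaulay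
      -- transform of the rank of v. The growth condition on G is exactly what keeps that product in
      -- the set.
      have h1 : lexRank (k + 1) (v + Finsupp.single k 1)
          ≤ lexRank (k + 1) (v + Finsupp.single i 1) := by
        rcases (show i ≤ k by omega).eq_or_lt with rfl | h
        · exact le_rfl
        · refine (lexRank_strictMono (fun j hj => ?_) ?_ (single_lex_lt h)).le
          · simp [hv j hj, Finsupp.single_eq_of_ne (show j ≠ k by omega)]
          · simp
      rw [lexRank_add_single_last k hv] at h1
      exact (hG.succ _ h0).trans ((macaulayPow_mono hu).trans h1)
    · rwa [Finsupp.filter_single_of_neg (fun x => x < m) hi, add_zero]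
  · intro u
    simp only [Set.mem_ofPred_eq]
    rw [filter_lt_eq_self (u := u.filter (· < m)) (fun j hj => filter_lt_apply_of_le u hj)]
  · intro u v hu hv hd hmem hlt
    simp only [Set.mem_ofPred_eq, filter_lt_eq_self hu, filter_lt_eq_self hv] at hmem ⊢
    rw [hd]
    exact hmem.trans (lexRank_strictMono hu hd.symm hlt).le
  · intro q
    rw [← card_filter_lexRank_lt (hG.le_card_mons q), standardCount]
    congr 1
    ext u
    simp only [Finset.mem_filter]
    refine and_congr_right fun hu => ?_
    have hu' := mem_mons.1 hu
    simp [filter_lt_eq_self hu'.2, hu'.1]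

/-- A lexsegment which does not depend on its last variable stays a lexsegment after adding
variables. -/
theorem LexBelow.lexAll {k : ℕ} {S : Set (ℕ →₀ ℕ)} (hlex : LexBelow (k + 1) S)
    (hup : IsUpperSet S) (hdet : DeterminedBelow k S) : LexAll S := by
  intro u v hd hu hlt
  obtain ⟨i, hi1, hi2⟩ := Finsupp.Lex.lt_iff.1 hlt
  simp only [ofLex_toLex] at hi1 hi2
  rw [hdet] at hu ⊢
  by_cases hik : i < k
  · set u0 := u.filter (· < k)
    set v0 := v.filter (· < k)
    have hu0 : ∀ j, k ≤ j → u0 j = 0 := fun j hj => filter_lt_apply_of_le u hj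
    have hv0 : ∀ j, k ≤ j → v0 j = 0 := fun j hj => filter_lt_apply_of_le v hj
    -- The truncations may have different degrees. Padding with powers of x_k equalises them without
    -- affecting membership, since S ignores x_k.
    obtain ⟨a, b, hab⟩ : ∃ a b, v0.degree + b = u0.degree + a :=
      ⟨v0.degree, u0.degree, add_comm _ _⟩
    have hV : v0 + Finsupp.single k b ∈ S := by
      refine hlex (u0 + Finsupp.single k a) _ (fun j hj => ?_) (fun j hj => ?_) (by simpa using hab)
        (hup (by simp) hu) (Finsupp.Lex.lt_iff.2 ⟨i, fun j hj => ?_, ?_⟩)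
      · simp [hu0 j (by omega), Finsupp.single_eq_of_ne (show j ≠ k by omega)]
      · simp [hv0 j (by omega), Finsupp.single_eq_of_ne (show j ≠ k by omega)]
      · simp [u0, v0, Finsupp.single_eq_of_ne (show j ≠ k by omega), show j < k by omega, hi1 j hj]
      · simp [u0, v0, Finsupp.single_eq_of_ne (show i ≠ k by omega), hik, hi2]
    rwa [hdet, Finsupp.filter_add, Finsupp.filter_single_of_neg (fun x => x < k) (by omega),
      add_zero, filter_lt_eq_self hv0] at hV
  · have : v.filter (· < k) = u.filter (· < k) := by
      ext j
      simp only [Finsupp.filter_apply]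
      split_ifs with h
      · exact (hi1 j (by omega)).symm
      · rfl
    rwa [this]

theorem LexAll.lexBelow {S : Set (ℕ →₀ ℕ)} (h : LexAll S) (m : ℕ) : LexBelow m S :=
  fun u v _ _ => h u v

/-- Factors x_k are stripped off one at a time. -/
theorem determinedBelow_of_regular {k : ℕ} {S : Set (ℕ →₀ ℕ)} (hup : IsUpperSet S)
    (hdet : DeterminedBelow (k + 1) S)
    (hreg : ∀ w : ℕ →₀ ℕ, (∀ j, k + 1 ≤ j → w j = 0) → w + Finsupp.single k 1 ∈ S → w ∈ S) :
    DeterminedBelow k S := by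
  intro u
  have hle : u.filter (· < k) ≤ u := by
    intro j
    rw [Finsupp.filter_apply]
    split_ifs <;> simp
  refine ⟨fun hu => ?_, fun hu => hup hle hu⟩
  rw [hdet] at hu
  have e : u.filter (· < k + 1) = u.filter (· < k) + Finsupp.single k (u k) := by
    ext j
    simp only [Finsupp.filter_apply, Finsupp.add_apply]
    rcases lt_trichotomy j k with h | rfl | h
    · simp [h, Finsupp.single_eq_of_ne h.ne, show j < k + 1 by omega]
    · simp
    · simp [Finsupp.single_eq_of_ne h.ne', show ¬ j < k + 1 by omega, show ¬ j < k by omega]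
  rw [e] at hu
  generalize u k = n at hu
  induction n with
  | zero => simpa using hu
  | succ n ih =>
    refine ih (hreg _ (fun j hj => ?_) ?_)
    · simp [Finsupp.single_eq_of_ne (show j ≠ k by omega), show ¬ j < k by omega]
    · rwa [add_assoc, ← Finsupp.single_add]

/-- Exponents outside S are split by divisibility by x_k; division by x_k does not affect membership
in S. -/
theorem standardCount_succ {k : ℕ} {S : Set (ℕ →₀ ℕ)} (hdet : DeterminedBelow k S) (q : ℕ) :
    standardCount S (k + 1) (q + 1) = standardCount S k (q + 1) + standardCount S (k + 1) q := by
  classical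
  have key : (mons (k + 1) (q + 1)).filter (fun u => u ∉ S) =
      ((mons k (q + 1)).filter fun u => u ∉ S) ∪
      ((mons (k + 1) q).filter fun u => u ∉ S).image (· + Finsupp.single k 1) := by
    have hS : ∀ w, w + Finsupp.single k 1 ∈ S ↔ w ∈ S := by
      intro w
      rw [hdet, hdet w, Finsupp.filter_add,
        Finsupp.filter_single_of_neg (fun x => x < k) (by omega), add_zero]
    ext u
    simp only [Finset.mem_filter, Finset.mem_union, Finset.mem_image, mem_mons]
    constructor
    · rintro ⟨⟨h1, h2⟩, h3⟩
      by_cases hu : u k = 0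
      · left
        refine ⟨⟨h1, fun j hj => ?_⟩, h3⟩
        rcases hj.eq_or_lt with rfl | h
        · exact hu
        · exact h2 j h
      · obtain ⟨w, rfl⟩ := exists_eq_add_single hu
        right
        refine ⟨w, ⟨⟨by simpa using h1, fun j hj => ?_⟩, by rwa [hS] at h3⟩, rfl⟩
        have := h2 j hj
        simp at this
        exact this.1
    · rintro (⟨⟨h1, h2⟩, h3⟩ | ⟨w, ⟨⟨h1, h2⟩, h3⟩, rfl⟩)
      · exact ⟨⟨h1, fun j hj => h2 j (by omega)⟩, h3⟩
      · refine ⟨⟨by simpa using h1, fun j hj => ?_⟩, by rwa [hS]⟩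
        simp [h2 j hj, Finsupp.single_eq_of_ne (show j ≠ k by omega)]
  have hdisj : Disjoint ((mons k (q + 1)).filter fun u => u ∉ S)
      (((mons (k + 1) q).filter fun u => u ∉ S).image (· + Finsupp.single k 1)) := by
    rw [Finset.disjoint_left]
    intro u h1 h2
    obtain ⟨w', -, rfl⟩ := Finset.mem_image.1 h2
    have := (mem_mons.1 (Finset.mem_filter.1 h1).1).2 k le_rfl
    simp at this
  rw [standardCount, key, Finset.card_union_of_disjoint hdisj,
    Finset.card_image_of_injective _ (add_left_injective _)]
  rfl

theorem standardCount_zero_right {S : Set (ℕ →₀ ℕ)} (h0 : 0 ∉ S) (m : ℕ) :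
    standardCount S m 0 = 1 := by
  classical
  have : (mons m 0).filter (fun u => u ∉ S) = {0} := by
    ext u
    simp only [Finset.mem_filter, mem_mons, Finset.mem_singleton, Finsupp.degree_eq_zero_iff]
    constructor
    · rintro ⟨⟨h, -⟩, -⟩
      exact h
    · rintro rfl
      simp [h0]
  rw [standardCount, this, Finset.card_singleton]

/-- If the last variable is regular modulo a lexsegment with counting function `H`, then `H`
has the smallest growth allowed by Green's theorem. -/
theorem LexBelow.greenPow_add_le {k : ℕ} {S : Set (ℕ →₀ ℕ)} (hlex : LexBelow (k + 1) S)
    (hreg : ∀ w : ℕ →₀ ℕ, (∀ j, k + 1 ≤ j → w j = 0) → w + Finsupp.single k 1 ∈ S → w ∈ S)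
    (q : ℕ) :
    greenPow (standardCount S (k + 1) (q + 1)) (q + 1) + standardCount S (k + 1) q
      ≤ standardCount S (k + 1) (q + 1) := by
  classical
  have hle := greenPow_le (standardCount S (k + 1) (q + 1)) (q + 1)
  rcases ((mons (k + 1) q).filter fun u => u ∉ S).eq_empty_or_nonempty with he | hne
  · rw [show standardCount S (k + 1) q = 0 by rw [standardCount, he, Finset.card_empty]]
    omega
  -- Let v be the largest standard exponent in degree q and b its rank. There are at most b + 1
  -- standard exponents in degree q. As v + e_k is standard too, degree q + 1 has more than the
  -- Macaulay transform of b.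
  · obtain ⟨v, hv, hmax⟩ := Finset.exists_max_image _ toLex hne
    simp only [Finset.mem_filter, mem_mons] at hv hmax
    obtain ⟨⟨hvq, hvs⟩, hvS⟩ := hv
    have h1 : standardCount S (k + 1) q ≤ lexRank (k + 1) v + 1 := by
      rw [lexRank, standardCount, hvq, ← Finset.card_insert_of_notMem (a := v) (by simp)]
      refine Finset.card_le_card fun u hu => ?_
      have hu' := hmax u (by simpa [mem_mons] using hu)
      simp only [Finset.mem_filter, mem_mons, Finset.mem_insert] at hu ⊢
      rcases hu'.eq_or_lt with h | h
      · exact Or.inl (toLex.injective h)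
      · exact Or.inr ⟨hu.1, h⟩
    have h2 : lexRank (k + 1) (v + Finsupp.single k 1) < standardCount S (k + 1) (q + 1) := by
      have hs : ∀ j, k + 1 ≤ j → (v + Finsupp.single k 1 : ℕ →₀ ℕ) j = 0 := by
        intro j hj
        simp [hvs j hj, Finsupp.single_eq_of_ne (show j ≠ k by omega)]
      refine Finset.card_lt_card ((Finset.ssubset_iff_of_subset fun u hu => ?_).2
        ⟨v + Finsupp.single k 1, ?_, by simp⟩)
      · simp only [Finset.mem_filter, mem_mons, degree_add_single, hvq] at hu ⊢
        refine ⟨hu.1, fun huS => hvS (hreg v hvs ?_)⟩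
        exact hlex u _ hu.1.2 hs (by simp [hu.1.1, hvq]) huS hu.2
      · simp only [Finset.mem_filter, mem_mons, degree_add_single, hvq]
        exact ⟨⟨trivial, hs⟩, fun h => hvS (hreg v hvs h)⟩
    rw [lexRank_add_single_last k hvs, hvq] at h2
    obtain ⟨e, he⟩ := Nat.exists_eq_add_of_le (show macaulayPow (lexRank (k + 1) v) q + 1
      ≤ standardCount S (k + 1) (q + 1) from h2)
    have h3 := _root_.greenPow_add_le (macaulayPow (lexRank (k + 1) v) q + 1) e (q + 1)
    have h4 := greenPow_macaulayPow_succ_add_le (q := q) (b := lexRank (k + 1) v) (by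
      rintro rfl
      rw [(Finsupp.degree_eq_zero_iff v).1 hvq, lexRank_zero])
    rw [he]
    omega

theorem degree_eq_sum_range_add {k : ℕ} {u : ℕ →₀ ℕ} (hu : ∀ j, k + 1 ≤ j → u j = 0) :
    u.degree = ∑ j ∈ Finset.range k, u j + u k := by
  rw [← Finset.sum_range_succ]
  refine (sum_eq_degree fun x hx => ?_).symm
  by_contra hx'
  exact (Finsupp.mem_support_iff.1 hx) (hu x (by simpa using hx'))

/-- Let i be the first place where z exceeds w x_k². A variable of z beyond x_i can be removed
without disturbing the comparison. If there is none, all remaining degree of z sits at i, so z_i ≥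
w_i + 2 and x_i itself can be removed. -/
theorem exists_lower_of_lex_le {k : ℕ} {w z : ℕ →₀ ℕ} (hw : ∀ j, k + 1 ≤ j → w j = 0) (hz : ∀ j, k + 1 ≤ j → z j = 0)
    (hd : z.degree = w.degree + 2)
    (hle : toLex (w + Finsupp.single k 1 + Finsupp.single k 1) ≤ toLex z) :
    ∃ j z', j ≤ k ∧ z = z' + Finsupp.single j 1 ∧ toLex (w + Finsupp.single k 1) ≤ toLex z' := by
  rcases hle.eq_or_lt with h | h
  · exact ⟨k, w + Finsupp.single k 1, le_rfl, (toLex.injective h).symm, le_rfl⟩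
  · obtain ⟨i, hi1, hi2⟩ := Finsupp.Lex.lt_iff.1 h
    simp only [ofLex_toLex] at hi1 hi2
    have hik : i ≤ k := by
      by_contra h'
      rw [hz i (by omega)] at hi2
      omega
    by_cases hex : ∃ j, i < j ∧ z j ≠ 0
    · obtain ⟨j, hj, hzj⟩ := hex
      obtain ⟨z', rfl⟩ := exists_eq_add_single hzj
      have hjk : j ≤ k := by
        by_contra h'
        exact hzj (hz j (by omega))
      refine ⟨j, z', hjk, rfl, (Finsupp.Lex.lt_iff.2 ⟨i, fun l hl => ?_, ?_⟩).le⟩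
      · have := hi1 l hl
        simpa [Finsupp.single_eq_of_ne (show l ≠ j by omega),
          Finsupp.single_eq_of_ne (show l ≠ k by omega)] using this
      · simpa [Finsupp.single_eq_of_ne (show i ≠ j by omega),
          Finsupp.single_eq_of_ne (show i ≠ k by omega)] using hi2
    · push Not at hex
      obtain ⟨z', rfl⟩ := exists_eq_add_single (show z i ≠ 0 by omega)
      have hsum : ∀ u : ℕ →₀ ℕ, ∑ j ∈ Finset.range i, u j + u i + (if i < k then u k else 0)
          ≤ u.degree := by
        intro u
        split_ifs with hlt
        · have : ∑ j ∈ insert k (insert i (Finset.range i)), u j ≤ u.degree := by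
            rw [Finsupp.degree_apply]
            exact Finset.sum_le_sum_of_ne_zero (fun x _ hx => by simpa using hx)
          rw [Finset.sum_insert (by simp; omega), Finset.sum_insert (by simp)] at this
          omega
        · have : ∑ j ∈ insert i (Finset.range i), u j ≤ u.degree := by
            rw [Finsupp.degree_apply]
            exact Finset.sum_le_sum_of_ne_zero (fun x _ hx => by simpa using hx)
          rw [Finset.sum_insert (by simp)] at this
          omega
      have h1 := hsum (w + Finsupp.single k 1 + Finsupp.single k 1)
      have h2 : (z' + Finsupp.single i 1).degree =
          ∑ j ∈ Finset.range i, (z' + Finsupp.single i 1 : ℕ →₀ ℕ) j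
            + (z' + Finsupp.single i 1 : ℕ →₀ ℕ) i := by
        exact degree_eq_sum_range_add fun x hx => hex x (by omega)
      have h3 : ∑ j ∈ Finset.range i, (z' + Finsupp.single i 1 : ℕ →₀ ℕ) j
          = ∑ j ∈ Finset.range i, (w + Finsupp.single k 1 + Finsupp.single k 1 : ℕ →₀ ℕ) j :=
        Finset.sum_congr rfl fun j hj => (hi1 j (Finset.mem_range.1 hj)).symm
      have h4 : i < k := by
        by_contra hc
        obtain rfl : i = k := by omega
        have h5 := degree_eq_sum_range_add (k := i)
          (u := w + Finsupp.single i 1 + Finsupp.single i 1) fun j hj => by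
            simp [hw j hj, Finsupp.single_eq_of_ne (show j ≠ i by omega)]
        simp only [degree_add_single] at h5 h2 hd
        omega
      refine ⟨i, z', hik, rfl, (Finsupp.Lex.lt_iff.2 ⟨i, fun l hl => ?_, ?_⟩).le⟩
      · have := hi1 l hl
        simpa [Finsupp.single_eq_of_ne (show l ≠ i by omega),
          Finsupp.single_eq_of_ne (show l ≠ k by omega)] using this
      · rw [if_pos h4] at h1
        simp only [degree_add_single] at h1 h2 hd
        simp [Finsupp.single_eq_of_ne (show i ≠ k by omega)] at h1 h2 hi2 ⊢
        simp at h3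
        omega

/-- The counting function of the complement of a universal lexsegment that depends on its last
variable is not the sum transform of a function satisfying Macaulay's conditions. -/
theorem LexAll.not_sum_transform {k : ℕ} {S : Set (ℕ →₀ ℕ)} (hlex : LexAll S)
    (hdet : DeterminedBelow (k + 1) S) {w : ℕ →₀ ℕ} (hw : ∀ j, k + 1 ≤ j → w j = 0)
    (hwS : w ∉ S) (hwk : w + Finsupp.single k 1 ∈ S) {G : ℕ → ℕ}
    (hG : ∀ q, 1 ≤ q → G (q + 1) ≤ macaulayPow (G q) q)
    (hsum : ∀ q, standardCount S (k + 1) (q + 1) = G (q + 1) + standardCount S (k + 1) q) :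
    False := by
  classical
  set q := w.degree with hq
  have hwk' : ∀ j, k + 1 ≤ j → (w + Finsupp.single k 1 : ℕ →₀ ℕ) j = 0 := by
    intro j hj
    simp [hw j hj, Finsupp.single_eq_of_ne (show j ≠ k by omega)]
  -- Everything from w x_k upwards lies in S, so standard exponents of degree q + 1 rank below w
  -- x_k.
  have h1 : standardCount S (k + 1) (q + 1) ≤ macaulayPow (lexRank (k + 1) w) q := by
    rw [hq, ← lexRank_add_single_last k hw, lexRank, degree_add_single]
    refine Finset.card_le_card fun u hu => ?_
    simp only [Finset.mem_filter, mem_mons] at hu ⊢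
    refine ⟨hu.1, lt_of_not_ge fun hle => hu.2 ?_⟩
    rcases hle.eq_or_lt with h | h
    · rwa [← toLex.injective h]
    · exact hlex _ u (by simp [hu.1.1]) hwk h
  have h2 : lexRank (k + 1) w < standardCount S (k + 1) q := by
    refine Finset.card_lt_card ((Finset.ssubset_iff_of_subset fun u hu => ?_).2 ⟨w, ?_, by simp⟩)
    · simp only [Finset.mem_filter, mem_mons] at hu ⊢
      exact ⟨hu.1, fun huS => hwS (hlex u w hu.1.1.symm huS hu.2)⟩
    · simp only [Finset.mem_filter, mem_mons]
      exact ⟨⟨hq.symm, hw⟩, hwS⟩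
  -- Growth from degree q + 1 to q + 2 is maximal because S has no new generators in degree q + 2:
  -- with v the least element of S in degree q + 1, everything of S in the next degree is at least v
  -- x_k.
  have h3 : macaulayPow (standardCount S (k + 1) (q + 1)) (q + 1)
      ≤ standardCount S (k + 1) (q + 2) := by
    obtain ⟨v, hv, hmin⟩ := Finset.exists_min_image ((mons (k + 1) (q + 1)).filter fun u => u ∈ S)
      toLex ⟨w + Finsupp.single k 1, by simpa [mem_mons, hq, hwk] using hwk'⟩
    simp only [Finset.mem_filter, mem_mons] at hv hmin
    obtain ⟨⟨hvq, hvs⟩, hvS⟩ := hv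
    have h4 : standardCount S (k + 1) (q + 1) = lexRank (k + 1) v := by
      rw [standardCount, lexRank, hvq]
      congr 1
      refine Finset.filter_congr fun u hu => ?_
      have hu' := mem_mons.1 hu
      constructor
      · intro huS
        refine lt_of_not_ge fun hle => huS ?_
        rcases hle.eq_or_lt with h | h
        · rwa [← toLex.injective h]
        · exact hlex v u (by rw [hu'.1, hvq]) hvS h
      · intro hlt huS
        exact absurd (hmin u ⟨hu', huS⟩) (not_le.2 hlt)
    rw [h4, ← hvq, ← lexRank_add_single_last k hvs, lexRank, degree_add_single, hvq]
    refine Finset.card_le_card fun z hz => ?_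
    simp only [Finset.mem_filter, mem_mons] at hz ⊢
    refine ⟨hz.1, fun hzS => ?_⟩
    -- Universality enters here. A smaller z in S would force w x_{k+1}² into S, and S ignores
    -- x_{k+1}, so w would be in S.
    have hzle : toLex (w + Finsupp.single k 1 + Finsupp.single k 1) ≤ toLex z := by
      refine le_of_not_gt fun hlt => hwS ?_
      have hbig : w + Finsupp.single (k + 1) 2 ∈ S := by
        refine hlex z _ (by simp [hz.1.1, hq]) hzS ?_
        obtain ⟨i, hi1, hi2⟩ := Finsupp.Lex.lt_iff.1 hlt
        simp only [ofLex_toLex] at hi1 hi2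
        have hik : i < k := by
          by_contra hc
          rcases (show k ≤ i by omega).eq_or_lt with rfl | hki
          · have hdz := degree_eq_sum_range_add hz.1.2
            have hdw := degree_eq_sum_range_add (k := k)
              (u := w + Finsupp.single k 1 + Finsupp.single k 1) fun j hj => by
                simp [hw j hj, Finsupp.single_eq_of_ne (show j ≠ k by omega)]
            have hs : ∑ j ∈ Finset.range k, z j
                = ∑ j ∈ Finset.range k, (w + Finsupp.single k 1 + Finsupp.single k 1 : ℕ →₀ ℕ) j :=
              Finset.sum_congr rfl fun j hj => hi1 j (Finset.mem_range.1 hj)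
            simp only [degree_add_single] at hdw
            have := hz.1.1
            omega
          · simp [hw i (by omega), Finsupp.single_eq_of_ne hki.ne'] at hi2
        refine Finsupp.Lex.lt_iff.2 ⟨i, fun j hj => ?_, ?_⟩
        · have := hi1 j hj
          simpa [Finsupp.single_eq_of_ne (show j ≠ k by omega),
            Finsupp.single_eq_of_ne (show j ≠ k + 1 by omega)] using this
        · simpa [Finsupp.single_eq_of_ne (show i ≠ k by omega),
            Finsupp.single_eq_of_ne (show i ≠ k + 1 by omega)] using hi2
      rwa [hdet, Finsupp.filter_add,
        Finsupp.filter_single_of_neg (fun x => x < k + 1) (by omega), add_zero,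
        filter_lt_eq_self hw] at hbig
    obtain ⟨j, z', hjk, rfl, hz'⟩ := exists_lower_of_lex_le hw hz.1.2 (by rw [hz.1.1]) hzle
    have hz's : ∀ j, k + 1 ≤ j → z' j = 0 := by
      intro l hl
      have := hz.1.2 l hl
      simp at this
      exact this.1
    have hz'q : z'.degree = q + 1 := by simpa using hz.1.1
    have hz'S : z' ∈ S := by
      rcases hz'.eq_or_lt with h | h
      · rwa [← toLex.injective h]
      · exact hlex _ z' (by rw [hz'q, degree_add_single]) hwk h
    have h5 := hmin z' ⟨⟨hz'q, hz's⟩, hz'S⟩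
    refine absurd hz.2 (not_lt.2 ?_)
    calc toLex (v + Finsupp.single k 1) ≤ toLex (z' + Finsupp.single k 1) := by
          rw [toLex_add, toLex_add]
          exact add_le_add_left h5 _
      _ ≤ toLex (z' + Finsupp.single j 1) := by
          rcases hjk.eq_or_lt with rfl | h
          · exact le_rfl
          · exact (single_lex_lt h).le
  -- With b the rank of w, the count in degree q + 1 is at most the Macaulay transform of b, while
  -- the count in degree q exceeds b. Their difference G (q + 1) therefore lies below Green's value,
  -- which contradicts the maximal growth in `h3`.
  have h6 : G (q + 1) < greenPow (standardCount S (k + 1) (q + 1)) (q + 1) := by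
    obtain ⟨e, he⟩ := Nat.exists_eq_add_of_le h1
    have h7 := macaulayPow_le_greenPow_add q (lexRank (k + 1) w)
    have h8 := greenPow_add_le (standardCount S (k + 1) (q + 1)) e (q + 1)
    rw [← he] at h8
    have := hsum q
    omega
  have h9 := macaulayPow_strictMono (show 1 ≤ q + 1 by omega) h6
  have h10 := macaulayPow_greenPow_add_le (show 1 ≤ q + 1 by omega)
    (standardCount S (k + 1) (q + 1))
  have h11 := hG (q + 1) (by omega)
  have h12 := hsum (q + 1)
  simp only [add_assoc, Nat.reduceAdd] at *
  omega

/-! ### Hyperplane restriction: the theorems of Green and Macaulay -/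

section LinearForms

variable {K : Type*} [Field K] {n : ℕ}

instance finite_homogeneousSubmodule (q : ℕ) :
    Module.Finite K (homogeneousSubmodule (Fin n) K q) :=
  Module.Finite.iff_fg.2 (homogeneousSubmodule_fg _ _ q)

theorem finite_of_le_homogeneousSubmodule {q : ℕ} {V : Submodule K (MvPolynomial (Fin n) K)}
    (h : V ≤ homogeneousSubmodule (Fin n) K q) : Module.Finite K V :=
  Submodule.finiteDimensional_of_le h

/-- The linear form `∑ c_i x_i`. -/
noncomputable def linForm (c : Fin n → K) : MvPolynomial (Fin n) K := ∑ i, C (c i) * X i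

theorem linForm_isHomogeneous (c : Fin n → K) : (linForm c).IsHomogeneous 1 :=
  IsHomogeneous.sum _ _ _ fun _ _ => isHomogeneous_C_mul_X _ _

theorem linForm_single (i : Fin n) : linForm (Pi.single i (1 : K)) = X i := by
  classical
  rw [linForm, Finset.sum_eq_single i]
  · simp
  · intro j _ hj
    simp [Pi.single_eq_of_ne hj]
  · simp

theorem linForm_mul (c : Fin n → K) (f : MvPolynomial (Fin n) K) :
    linForm c * f = ∑ i, c i • (X i * f) := by
  rw [linForm, Finset.sum_mul]
  exact Finset.sum_congr rfl fun i _ => by rw [mul_assoc, ← smul_eq_C_mul]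

theorem linForm_mul_mem {c : Fin n → K} {f : MvPolynomial (Fin n) K}
    {V : Submodule K (MvPolynomial (Fin n) K)} (h : ∀ i, X i * f ∈ V) : linForm c * f ∈ V := by
  rw [linForm_mul]
  exact V.sum_mem fun i _ => V.smul_mem _ (h i)

/-- The products of the linear form `linForm c` with the forms of degree `q`. -/
noncomputable def linMul (c : Fin n → K) (q : ℕ) : Submodule K (MvPolynomial (Fin n) K) :=
  (homogeneousSubmodule (Fin n) K q).map (LinearMap.mulLeft K (linForm c))

theorem linMul_le (c : Fin n → K) (q : ℕ) : linMul c q ≤ homogeneousSubmodule (Fin n) K (q + 1) := by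
  rintro _ ⟨f, hf, rfl⟩
  have := (linForm_isHomogeneous c).mul ((mem_homogeneousSubmodule _ _).1 hf)
  rwa [add_comm] at this

/-- The forms of degree `q` whose product with the linear form `linForm c` lies in `V`. -/
noncomputable def linColon (c : Fin n → K) (q : ℕ) (V : Submodule K (MvPolynomial (Fin n) K)) :
    Submodule K (MvPolynomial (Fin n) K) :=
  V.comap (LinearMap.mulLeft K (linForm c)) ⊓ homogeneousSubmodule (Fin n) K q

theorem mem_linColon {c : Fin n → K} {q : ℕ} {V : Submodule K (MvPolynomial (Fin n) K)}
    {f : MvPolynomial (Fin n) K} :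
    f ∈ linColon c q V ↔ linForm c * f ∈ V ∧ f ∈ homogeneousSubmodule (Fin n) K q :=
  Iff.rfl

theorem linColon_le (c : Fin n → K) (q : ℕ) (V : Submodule K (MvPolynomial (Fin n) K)) :
    linColon c q V ≤ homogeneousSubmodule (Fin n) K q :=
  inf_le_right

/-- The codimension of a space of forms of degree `q`. -/
noncomputable def codim (q : ℕ) (V : Submodule K (MvPolynomial (Fin n) K)) : ℕ :=
  Module.finrank K (homogeneousSubmodule (Fin n) K q) - Module.finrank K V

theorem finrank_add_codim {q : ℕ} {V : Submodule K (MvPolynomial (Fin n) K)}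
    (h : V ≤ homogeneousSubmodule (Fin n) K q) :
    Module.finrank K V + codim q V = Module.finrank K (homogeneousSubmodule (Fin n) K q) :=
  Nat.add_sub_cancel' (Submodule.finrank_mono h)

theorem codim_anti {q : ℕ} {U V : Submodule K (MvPolynomial (Fin n) K)} (h : U ≤ V)
    (hV : V ≤ homogeneousSubmodule (Fin n) K q) : codim q V ≤ codim q U := by
  have := finite_of_le_homogeneousSubmodule hV
  have := Submodule.finrank_mono h
  unfold codim
  omega

theorem eq_of_le_of_codim_le {q : ℕ} {U V : Submodule K (MvPolynomial (Fin n) K)} (h : U ≤ V)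
    (hV : V ≤ homogeneousSubmodule (Fin n) K q) (hc : codim q U ≤ codim q V) : U = V := by
  have := finite_of_le_homogeneousSubmodule hV
  have h1 := finrank_add_codim hV
  have h2 := finrank_add_codim (h.trans hV)
  exact Submodule.eq_of_le_of_finrank_le h (by omega)

/-- Dimension count in the exact sequence formed by multiplication by a linear form l from A_q/(V :
l) to A_{q+1}/V, with cokernel A_{q+1}/(V + l A_q). It remains valid for l = 0. -/
theorem codim_eq_add {q : ℕ} {V : Submodule K (MvPolynomial (Fin n) K)}
    (hV : V ≤ homogeneousSubmodule (Fin n) K (q + 1)) (c : Fin n → K) :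
    codim (q + 1) V = codim (q + 1) (V ⊔ linMul c q) + codim q (linColon c q V) := by
  by_cases hl : linForm c = 0
  · have h1 : linMul c q = ⊥ := by
      rw [linMul, hl]
      simp
    have h2 : linColon c q V = homogeneousSubmodule (Fin n) K q := by
      refine le_antisymm (linColon_le _ _ _) fun f hf => ⟨?_, hf⟩
      simp [hl]
    rw [h1, h2, sup_bot_eq]
    simp [codim]
  · have hinj : Function.Injective (LinearMap.mulLeft K (linForm c)) := mul_right_injective₀ hl
    have := finite_of_le_homogeneousSubmodule hV
    have := finite_of_le_homogeneousSubmodule (linMul_le c q)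
    have h1 := Submodule.finrank_sup_add_finrank_inf_eq V (linMul c q)
    have h2 : Module.finrank K (linMul c q)
        = Module.finrank K (homogeneousSubmodule (Fin n) K q) :=
      (LinearEquiv.finrank_eq (Submodule.equivMapOfInjective _ hinj _)).symm
    have h3 : V ⊓ linMul c q = (linColon c q V).map (LinearMap.mulLeft K (linForm c)) := by
      ext f
      constructor
      · rintro ⟨hf, g, hg, rfl⟩
        exact ⟨g, ⟨hf, hg⟩, rfl⟩
      · rintro ⟨g, ⟨hg1, hg2⟩, rfl⟩
        exact ⟨hg1, g, hg2, rfl⟩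
    have h4 : Module.finrank K ((linColon c q V).map (LinearMap.mulLeft K (linForm c)))
        = Module.finrank K (linColon c q V) :=
      (LinearEquiv.finrank_eq (Submodule.equivMapOfInjective _ hinj _)).symm
    rw [h3, h4, h2] at h1
    have h5 := finrank_add_codim hV
    have h6 := finrank_add_codim (sup_le hV (linMul_le c q))
    have h7 := finrank_add_codim (linColon_le c q V)
    omega

/-- A property of linear forms holding on a nonempty Zariski open set. -/
def Generic (P : (Fin n → K) → Prop) : Prop :=
  ∃ F : MvPolynomial (Fin n) K, F ≠ 0 ∧ ∀ c, eval c F ≠ 0 → P c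

theorem Generic.mono {P Q : (Fin n → K) → Prop} (h : Generic P) (hPQ : ∀ c, P c → Q c) :
    Generic Q := by
  obtain ⟨F, hF, h⟩ := h
  exact ⟨F, hF, fun c hc => hPQ c (h c hc)⟩

theorem Generic.and {P Q : (Fin n → K) → Prop} (hP : Generic P) (hQ : Generic Q) :
    Generic fun c => P c ∧ Q c := by
  obtain ⟨F, hF, hP⟩ := hP
  obtain ⟨G, hG, hQ⟩ := hQ
  refine ⟨F * G, mul_ne_zero hF hG, fun c hc => ?_⟩
  rw [map_mul] at hc
  exact ⟨hP c (left_ne_zero_of_mul hc), hQ c (right_ne_zero_of_mul hc)⟩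

theorem Generic.exists [Infinite K] {P : (Fin n → K) → Prop} (hP : Generic P) : ∃ c, P c := by
  obtain ⟨F, hF, hP⟩ := hP
  by_contra! h
  refine hF (MvPolynomial.funext fun c => ?_)
  rw [map_zero]
  by_contra hc
  exact h c (hP c hc)

theorem generic_true {P : (Fin n → K) → Prop} (h : ∀ c, P c) : Generic P :=
  ⟨1, one_ne_zero, fun c _ => h c⟩

/-- Lower semicontinuity of the dimension of `V + l A_q` in the linear form `l`. -/
theorem generic_codim_sup_linMul_le {q : ℕ} {V : Submodule K (MvPolynomial (Fin n) K)}
    (hV : V ≤ homogeneousSubmodule (Fin n) K (q + 1)) (c₁ : Fin n → K) :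
    Generic fun c => codim (q + 1) (V ⊔ linMul c q) ≤ codim (q + 1) (V ⊔ linMul c₁ q) := by
  classical
  have hU : ∀ c, V ⊔ linMul c q ≤ homogeneousSubmodule (Fin n) K (q + 1) :=
    fun c => sup_le hV (linMul_le c q)
  have hfin : ∀ c, Module.Finite K ↥(V ⊔ linMul c q) :=
    fun c => finite_of_le_homogeneousSubmodule (hU c)
  let ρ := Module.finrank K ↥(V ⊔ linMul c₁ q)
  let b : Module.Basis (Fin ρ) K ↥(V ⊔ linMul c₁ q) := Module.finBasis K _
  have hb : ∀ i, ∃ v ∈ V, ∃ g ∈ homogeneousSubmodule (Fin n) K q,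
      v + linForm c₁ * g = (b i : MvPolynomial (Fin n) K) := by
    intro i
    obtain ⟨v, hv, _, ⟨g, hg, rfl⟩, h⟩ := Submodule.mem_sup.1 (b i).2
    exact ⟨v, hv, g, hg, h⟩
  choose v hv g hg hvg using hb
  obtain ⟨ψ, hψ⟩ := LinearMap.exists_extend (b.equivFun : ↥(V ⊔ linMul c₁ q) →ₗ[K] (Fin ρ → K))
  have hψb : ∀ i, ψ (v i + linForm c₁ * g i) = Pi.single i 1 := by
    intro i
    rw [hvg]
    have := LinearMap.congr_fun hψ (b i)
    simp only [LinearMap.comp_apply, Submodule.subtype_apply, LinearEquiv.coe_coe] at this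
    rw [this]
    ext j
    simp [Pi.single_apply, eq_comm]
  -- A basis of V + l₁A_q has the form v_i + l₁g_i. In coordinates extending this basis, the vectors
  -- v_i + l g_i have a determinant polynomial in the coefficients of l, equal to 1 at l₁. Where it
  -- does not vanish, V + l A_q is at least as large.
  let P : Matrix (Fin ρ) (Fin ρ) (MvPolynomial (Fin n) K) :=
    Matrix.of fun i j => C (ψ (v i) j) + ∑ k, X k * C (ψ (X k * g i) j)
  have hP : ∀ c, eval c P.det = (Matrix.of fun i => ψ (v i + linForm c * g i)).det := by
    intro c
    rw [RingHom.map_det]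
    congr 1
    ext i j
    simp [P, linForm_mul]
  refine ⟨P.det, ?_, fun c hc => ?_⟩
  · intro h0
    have := hP c₁
    rw [h0, map_zero] at this
    have h1 : (Matrix.of fun i => ψ (v i + linForm c₁ * g i)) = (1 : Matrix (Fin ρ) (Fin ρ) K) := by
      ext i j
      rw [Matrix.of_apply, hψb, Matrix.one_apply, Pi.single_apply]
      simp [eq_comm]
    rw [h1, Matrix.det_one] at this
    exact zero_ne_one this
  · rw [hP] at hc
    have hli : LinearIndependent K fun i => ψ (v i + linForm c * g i) :=
      Matrix.linearIndependent_rows_of_det_ne_zero hc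
    have hmem : ∀ i, v i + linForm c * g i ∈ V ⊔ linMul c q := fun i =>
      Submodule.add_mem_sup (hv i) ⟨g i, hg i, rfl⟩
    have hli2 : LinearIndependent K fun i => (⟨v i + linForm c * g i, hmem i⟩ :
        ↥(V ⊔ linMul c q)) :=
      LinearIndependent.of_comp (ψ.comp (V ⊔ linMul c q).subtype) hli
    have h1 := hli2.fintype_card_le_finrank
    rw [Fintype.card_fin] at h1
    unfold codim
    omega

theorem homogeneousSubmodule_succ_le {q : ℕ} {V : Submodule K (MvPolynomial (Fin n) K)}
    (h : ∀ c, linMul c q ≤ V) : homogeneousSubmodule (Fin n) K (q + 1) ≤ V := by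
  intro f hf
  rw [f.as_sum]
  refine V.sum_mem fun u hu => ?_
  have hdeg : u.degree = q + 1 := by
    by_contra hne
    exact (mem_support_iff.1 hu) (((mem_homogeneousSubmodule _ _).1 hf).coeff_eq_zero hne)
  obtain ⟨i, hi⟩ : ∃ i, u i ≠ 0 := by
    by_contra! h0
    rw [show u = 0 from Finsupp.ext h0] at hdeg
    simp at hdeg
  obtain ⟨w, rfl⟩ : ∃ w, u = Finsupp.single i 1 + w :=
    ⟨u - Finsupp.single i 1, (add_tsub_cancel_of_le (by simpa [Nat.one_le_iff_ne_zero] using hi)).symm⟩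
  refine h (Pi.single i 1) ⟨monomial w (coeff (Finsupp.single i 1 + w) f), ?_, ?_⟩
  · refine isHomogeneous_monomial _ ?_
    simp at hdeg
    omega
  · rw [LinearMap.mulLeft_apply, linForm_single, X, monomial_mul, one_mul]

theorem linMul_le_linColon (c₁ c₂ : Fin n → K) (p : ℕ) (V : Submodule K (MvPolynomial (Fin n) K)) :
    linMul c₂ p ≤ linColon c₁ (p + 1) (V ⊔ linMul c₂ (p + 1)) := by
  intro f hf
  obtain ⟨g, hg, rfl⟩ := Submodule.mem_map.1 hf
  refine mem_linColon.2 ⟨Submodule.mem_sup_right (Submodule.mem_map.2 ⟨linForm c₁ * g, ?_, ?_⟩),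
    linMul_le c₂ p hf⟩
  · exact linMul_le c₁ p (Submodule.mem_map_of_mem hg)
  · rw [LinearMap.mulLeft_apply, LinearMap.mulLeft_apply, mul_left_comm]

/-- Inductive step of Green's theorem: induction on the codimension, with the case of degree q
supplied as a hypothesis. That hypothesis speaks of spaces W rather than of U + l A_{q-1}, so that
it also makes sense for q = 0, where `greenPow` is the identity. -/
theorem generic_codim_le_greenPow_of_colon [Infinite K] (q : ℕ)
    (hq : ∀ U ≤ homogeneousSubmodule (Fin n) K q, Generic fun c =>
      ∀ W ≤ homogeneousSubmodule (Fin n) K q, U ≤ W → (∀ p, q = p + 1 → linMul c p ≤ W) →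
        codim q W ≤ greenPow (codim q U) q)
    (V : Submodule K (MvPolynomial (Fin n) K))
    (hV : V ≤ homogeneousSubmodule (Fin n) K (q + 1)) :
    Generic fun c => codim (q + 1) (V ⊔ linMul c q) ≤ greenPow (codim (q + 1) V) (q + 1) := by
  generalize ha : codim (q + 1) V = a
  induction a using Nat.strong_induction_on generalizing V with
  | _ a ih =>
  have hU : ∀ c, V ⊔ linMul c q ≤ homogeneousSubmodule (Fin n) K (q + 1) :=
    fun c => sup_le hV (linMul_le c q)
  obtain ⟨c₁, hmin⟩ : ∃ c₁, ∀ c, codim (q + 1) (V ⊔ linMul c₁ q) ≤ codim (q + 1) (V ⊔ linMul c q) :=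
    ⟨_, fun c => Function.argmin_le (fun c => codim (q + 1) (V ⊔ linMul c q)) c⟩
  suffices hs : codim (q + 1) (V ⊔ linMul c₁ q) ≤ greenPow a (q + 1) from
    (generic_codim_sup_linMul_le hV c₁).mono fun c hc => hc.trans hs
  by_contra! hlt
  have hle : codim (q + 1) (V ⊔ linMul c₁ q) ≤ a := ha ▸ codim_anti le_sup_left (hU c₁)
  -- If the best linear form does not lower the codimension, then by minimality no form does. All l
  -- A_q then lie in V, and V is the whole space.
  rcases hle.eq_or_lt with heq | hlt2
  · have h1 : ∀ c, linMul c q ≤ V := by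
      intro c
      have := eq_of_le_of_codim_le (le_sup_left : V ≤ V ⊔ linMul c q) (hU c)
        (by rw [ha, ← heq]; exact hmin c)
      rw [this]
      exact le_sup_right
    have h2 : codim (q + 1) V = 0 := by
      have := finite_of_le_homogeneousSubmodule hV
      have := Submodule.finrank_mono (homogeneousSubmodule_succ_le h1)
      unfold codim
      omega
    omega
  · have h1 := codim_eq_add hV c₁
    -- A second form l₂ is taken generic both for V + l₁A_q and for V : l₁. The codimension of V +
    -- l₂A_q, computed by cutting with l₁, is bounded by the two Green values, and the numerical
    -- inequality puts it below the minimum.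
    obtain ⟨c₂, hc2, hc3⟩ := ((ih _ hlt2 (V ⊔ linMul c₁ q) (hU c₁) rfl).and
      (hq (linColon c₁ q V) (linColon_le _ _ _))).exists
    have h2 := codim_eq_add (hU c₂) c₁
    have h3 := hc3 (linColon c₁ q (V ⊔ linMul c₂ q)) (linColon_le _ _ _)
      (fun f hf => ⟨Submodule.mem_sup_left hf.1, hf.2⟩) (by
        rintro p rfl
        exact linMul_le_linColon c₁ c₂ p V)
    have h4 := greenPow_add_greenPow_lt hlt hle
    have h5 := hmin c₂
    rw [show a - codim (q + 1) (V ⊔ linMul c₁ q) = codim q (linColon c₁ q V) by omega] at h4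
    rw [sup_right_comm] at h2
    omega

/-- Green's theorem on hyperplane restrictions. -/
theorem generic_codim_le_greenPow [Infinite K] (q : ℕ) (V : Submodule K (MvPolynomial (Fin n) K))
    (hV : V ≤ homogeneousSubmodule (Fin n) K (q + 1)) :
    Generic fun c => codim (q + 1) (V ⊔ linMul c q) ≤ greenPow (codim (q + 1) V) (q + 1) := by
  induction q generalizing V with
  | zero =>
    refine generic_codim_le_greenPow_of_colon 0 (fun U _ => generic_true fun c W hW hUW _ => ?_) V hV
    exact codim_anti hUW hW
  | succ q ih =>
    refine generic_codim_le_greenPow_of_colon (q + 1) (fun U hU => (ih U hU).mono ?_) V hV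
    intro c hc W hW hUW hlin
    exact (codim_anti (sup_le hUW (hlin q rfl)) hW).trans hc

/-- Macaulay's theorem for consecutive graded pieces. -/
theorem codim_le_macaulayPow [Infinite K] {q : ℕ} {U V : Submodule K (MvPolynomial (Fin n) K)}
    (hU : U ≤ homogeneousSubmodule (Fin n) K (q + 1))
    (hV : V ≤ homogeneousSubmodule (Fin n) K (q + 2))
    (hUV : ∀ i, ∀ f ∈ U, X i * f ∈ V) :
    codim (q + 2) V ≤ macaulayPow (codim (q + 1) U) (q + 1) := by
  obtain ⟨c, hc⟩ := (generic_codim_le_greenPow (q + 1) V hV).exists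
  have h1 := codim_eq_add hV c
  have h2 : codim (q + 1) (linColon c (q + 1) V) ≤ codim (q + 1) U :=
    codim_anti (fun f hf => ⟨linForm_mul_mem fun i => hUV i f hf, hU hf⟩) (linColon_le _ _ _)
  -- Above the Macaulay bound, the drop in codimension forced by Green's theorem would exceed the
  -- codimension of U, whereas the drop equals that of a colon space containing U.
  by_contra! hlt
  obtain ⟨e, he⟩ := Nat.exists_eq_add_of_le
    (show macaulayPow (codim (q + 1) U) (q + 1) + 1 ≤ codim (q + 2) V from hlt)
  have h3 := greenPow_add_le (macaulayPow (codim (q + 1) U) (q + 1) + 1) e (q + 2)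
  have h4 := greenPow_macaulayPow_succ_add_le (q := q + 1) (b := codim (q + 1) U) (by simp)
  rw [← he] at h3
  simp only [add_assoc, Nat.reduceAdd] at *
  omega

/-- In the extremal case of Green's theorem some linear form is injective modulo the given
spaces. -/
theorem exists_linColon_eq [Infinite K] {q : ℕ} {U V : Submodule K (MvPolynomial (Fin n) K)}
    (hU : U ≤ homogeneousSubmodule (Fin n) K q)
    (hV : V ≤ homogeneousSubmodule (Fin n) K (q + 1))
    (hUV : ∀ i, ∀ f ∈ U, X i * f ∈ V)
    (hext : greenPow (codim (q + 1) V) (q + 1) + codim q U ≤ codim (q + 1) V) :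
    ∃ c, U = linColon c q V := by
  obtain ⟨c, hc⟩ := (generic_codim_le_greenPow q V hV).exists
  have h1 := codim_eq_add hV c
  exact ⟨c, eq_of_le_of_codim_le (fun f hf => ⟨linForm_mul_mem fun i => hUV i f hf, hU hf⟩)
    (linColon_le _ _ _) (by omega)⟩

end LinearForms

/-! ### Regular sequences and the invariance of depth -/

section Depth

variable {R : Type*} [CommRing R]

/-- `h` is a nonzerodivisor on `R ⧸ I`. -/
def RegularMod (h : R) (I : Ideal R) : Prop := ∀ f, h * f ∈ I → f ∈ I

/-- There is a weakly regular sequence of length `r` on `R ⧸ I` in the ideal `m`. -/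
def DepthGE (m : Ideal R) : ℕ → Ideal R → Prop
  | 0, _ => True
  | r + 1, I => ∃ h ∈ m, RegularMod h I ∧ DepthGE m r (I ⊔ Ideal.span {h})

/-- No nonzero element of `R ⧸ I` is annihilated by `m`. -/
def NoSocle (m I : Ideal R) : Prop := ∀ z ∉ I, ∃ a ∈ m, a * z ∉ I

theorem mem_sup_span_singleton {I : Ideal R} {h f : R} :
    f ∈ I ⊔ Ideal.span {h} ↔ ∃ g, f - h * g ∈ I := by
  rw [Submodule.mem_sup]
  constructor
  · rintro ⟨i, hi, x, hx, rfl⟩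
    obtain ⟨g, rfl⟩ := Ideal.mem_span_singleton'.1 hx
    exact ⟨g, by rwa [mul_comm, add_sub_cancel_right]⟩
  · rintro ⟨g, hg⟩
    exact ⟨_, hg, h * g, Ideal.mul_mem_right _ _ (Ideal.mem_span_singleton_self h), by ring⟩

theorem RegularMod.noSocle {m I : Ideal R} {h : R} (hh : RegularMod h I) (hm : h ∈ m) :
    NoSocle m I := fun z hz => ⟨h, hm, fun h' => hz (hh z h')⟩

theorem DepthGE.noSocle {m I : Ideal R} {r : ℕ} (h : DepthGE m (r + 1) I) : NoSocle m I := by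
  obtain ⟨h, hm, hh, -⟩ := h
  exact hh.noSocle hm

theorem DepthGE.of_succ {m : Ideal R} {r : ℕ} {I : Ideal R} (h : DepthGE m (r + 1) I) :
    DepthGE m r I := by
  induction r generalizing I with
  | zero => trivial
  | succ r ih =>
    obtain ⟨h, hm, hh, h'⟩ := h
    exact ⟨h, hm, hh, ih h'⟩

theorem DepthGE.mono {m : Ideal R} {r s : ℕ} {I : Ideal R} (h : DepthGE m s I) (hrs : r ≤ s) :
    DepthGE m r I := by
  induction s, hrs using Nat.le_induction with
  | base => exact h
  | succ s _ ih => exact ih h.of_succ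

/-- An associated prime containing m equals m, hence is the annihilator of some class, and that
class would be a socle element. -/
theorem NoSocle.not_le_of_mem_associatedPrimes [IsNoetherianRing R] {m I : Ideal R} [m.IsMaximal]
    (h : NoSocle m I) {P : Ideal R} (hP : P ∈ associatedPrimes R (R ⧸ I)) : ¬ m ≤ P := by
  intro hle
  have hprime : P.IsPrime := hP.isPrime
  obtain rfl := Ideal.IsMaximal.eq_of_le ‹_› hprime.ne_top hle
  obtain ⟨-, x, hx⟩ := isAssociatedPrime_iff.1 hP
  obtain ⟨z, rfl⟩ := Ideal.Quotient.mk_surjective x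
  have key : ∀ a, a ∈ m ↔ a * z ∈ I := by
    intro a
    rw [hx, Submodule.mem_colon_singleton, Submodule.mem_bot, ← Ideal.Quotient.eq_zero_iff_mem]
    rfl
  by_cases hz : z ∈ I
  · exact hprime.ne_top ((Ideal.eq_top_iff_one _).2 ((key 1).2 (by simpa using hz)))
  · obtain ⟨a, ha, haz⟩ := h z hz
    exact haz ((key a).1 ha)

theorem regularMod_of_notMem_associatedPrimes [IsNoetherianRing R] {I : Ideal R} {h : R}
    (hh : ∀ P ∈ associatedPrimes R (R ⧸ I), h ∉ P) : RegularMod h I := by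
  have h1 := biUnion_associatedPrimes_eq_compl_regular R (R ⧸ I)
  have h2 : IsSMulRegular (R ⧸ I) h := by
    by_contra hc
    have : h ∈ ⋃ p ∈ associatedPrimes R (R ⧸ I), (p : Set R) := by
      rw [h1]
      exact hc
    simp only [Set.mem_iUnion] at this
    obtain ⟨P, hP, hhP⟩ := this
    exact hh P hP hhP
  intro f hf
  rw [← Ideal.Quotient.eq_zero_iff_mem]
  refine h2.right_eq_zero_of_smul ?_
  exact Ideal.Quotient.eq_zero_iff_mem.2 hf

/-- Prime avoidance applied to the associated primes of both quotients at once. The exchange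
argument needs one element that is regular modulo two ideals. -/
theorem exists_regularMod_regularMod [IsNoetherianRing R] {m I J : Ideal R} [m.IsMaximal]
    (hI : NoSocle m I) (hJ : NoSocle m J) : ∃ h ∈ m, RegularMod h I ∧ RegularMod h J := by
  have hfin : (associatedPrimes R (R ⧸ I) ∪ associatedPrimes R (R ⧸ J)).Finite :=
    (associatedPrimes.finite R (R ⧸ I)).union (associatedPrimes.finite R (R ⧸ J))
  have hnot : ¬ (m : Set R) ⊆
      ⋃ P ∈ associatedPrimes R (R ⧸ I) ∪ associatedPrimes R (R ⧸ J), (P : Set R) := by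
    intro hsub
    obtain ⟨P, hP, hle⟩ := (Ideal.subset_union_prime_finite hfin (f := id) m m
      (fun P hP _ _ => hP.elim (fun h => h.isPrime) (fun h => h.isPrime))).1 hsub
    rcases hP with hP | hP
    · exact hI.not_le_of_mem_associatedPrimes hP hle
    · exact hJ.not_le_of_mem_associatedPrimes hP hle
  obtain ⟨h, hm, hh⟩ := Set.not_subset.1 hnot
  simp only [Set.mem_iUnion, not_exists] at hh
  exact ⟨h, hm, regularMod_of_notMem_associatedPrimes fun P hP => hh P (Or.inl hP),
    regularMod_of_notMem_associatedPrimes fun P hP => hh P (Or.inr hP)⟩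

theorem NoSocle.exists_regularMod [IsNoetherianRing R] {m I : Ideal R} [m.IsMaximal]
    (hI : NoSocle m I) : ∃ h ∈ m, RegularMod h I := by
  obtain ⟨h, hm, hh, -⟩ := exists_regularMod_regularMod hI hI
  exact ⟨h, hm, hh⟩

/-- The half of permutability that needs no Nakayama argument: from az ≡ cw, regularity of c modulo
a gives w ≡ av, and a is cancelled. -/
theorem RegularMod.swap {I : Ideal R} {a c : R} (ha : RegularMod a I)
    (hc : RegularMod c (I ⊔ Ideal.span {a})) : RegularMod a (I ⊔ Ideal.span {c}) := by
  intro z hz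
  obtain ⟨w, hw⟩ := mem_sup_span_singleton.1 hz
  obtain ⟨v, hv⟩ := mem_sup_span_singleton.1 (hc w (mem_sup_span_singleton.2 ⟨z, by
    rw [← neg_mem_iff]; simpa using hw⟩))
  refine mem_sup_span_singleton.2 ⟨v, ha _ ?_⟩
  have : a * (z - c * v) = (a * z - c * w) + c * (w - a * v) := by ring
  rw [this]
  exact I.add_mem hw (I.mul_mem_left _ hv)

/-- The socles modulo a and modulo h are both Ext¹(R/m, R/I). Concretely, a socle element z modulo h
gives az ≡ hw, and w is a socle element modulo a. -/
theorem NoSocle.of_sup_span_singleton {m I : Ideal R} {a h : R} (ha : RegularMod a I)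
    (hh : RegularMod h I) (ham : a ∈ m) (hns : NoSocle m (I ⊔ Ideal.span {a})) :
    NoSocle m (I ⊔ Ideal.span {h}) := by
  intro z hz
  by_contra! hc
  obtain ⟨w, hw⟩ := mem_sup_span_singleton.1 (hc a ham)
  have hwa : w ∉ I ⊔ Ideal.span {a} := by
    intro hwa
    obtain ⟨v, hv⟩ := mem_sup_span_singleton.1 hwa
    refine hz (mem_sup_span_singleton.2 ⟨v, ha _ ?_⟩)
    have : a * (z - h * v) = (a * z - h * w) + h * (w - a * v) := by ring
    rw [this]
    exact I.add_mem hw (I.mul_mem_left _ hv)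
  obtain ⟨b, hb, hbw⟩ := hns w hwa
  obtain ⟨y, hy⟩ := mem_sup_span_singleton.1 (hc b hb)
  refine hbw (mem_sup_span_singleton.2 ⟨y, hh _ ?_⟩)
  have : h * (b * w - a * y) = a * (b * z - h * y) - b * (a * z - h * w) := by ring
  rw [this]
  exact I.sub_mem (I.mul_mem_left _ hy) (I.mul_mem_left _ hw)

/-- All maximal regular sequences have the same length (Rees). -/
theorem DepthGE.sup_span_singleton [IsNoetherianRing R] {m : Ideal R} [m.IsMaximal] {r : ℕ}
    {I : Ideal R} (hI : DepthGE m (r + 1) I) {h : R} (hm : h ∈ m) (hh : RegularMod h I) :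
    DepthGE m r (I ⊔ Ideal.span {h}) := by
  induction r generalizing I h with
  | zero => trivial
  | succ r ih =>
    obtain ⟨a, ham, ha, hIa⟩ := hI
    -- An element c regular modulo both I + (a) and I + (h) serves as intermediary: a is exchanged
    -- for c, then c for h, with the induction hypothesis used each time.
    obtain ⟨c, hcm, hca, hch⟩ := exists_regularMod_regularMod hIa.noSocle
      (NoSocle.of_sup_span_singleton ha hh ham hIa.noSocle)
    have h1 : DepthGE m r (I ⊔ Ideal.span {c} ⊔ Ideal.span {a}) := by
      rw [sup_right_comm]
      exact ih hIa hcm hca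
    have h2 : DepthGE m r (I ⊔ Ideal.span {c} ⊔ Ideal.span {h}) :=
      ih ⟨a, ham, ha.swap hca, h1⟩ hm (hh.swap hch)
    rw [sup_right_comm] at h2
    exact ⟨c, hcm, hch, h2⟩

theorem depthGE_succ_iff [IsNoetherianRing R] {m : Ideal R} [m.IsMaximal] {r : ℕ}
    {I : Ideal R} {h : R} (hm : h ∈ m) (hh : RegularMod h I) :
    DepthGE m (r + 1) I ↔ DepthGE m r (I ⊔ Ideal.span {h}) :=
  ⟨fun hI => hI.sup_span_singleton hm hh, fun hI => ⟨h, hm, hh, hI⟩⟩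

open Pointwise in
/-- Reduction of `R ⧸ I` modulo `h`. -/
noncomputable def quotSMulTopQuotientEquiv (I : Ideal R) (h : R) :
    QuotSMulTop h (R ⧸ I) ≃ₗ[R] R ⧸ (I ⊔ Ideal.span {h}) :=
  Submodule.quotEquivOfEq _ _ (by
      rw [Submodule.map_pointwise_smul, Submodule.map_top, Submodule.range_mkQ]) ≪≫ₗ
    Submodule.quotientQuotientEquivQuotientSup I (h • (⊤ : Submodule R R)) ≪≫ₗ
    Submodule.quotEquivOfEq _ _ (by
      rw [← Submodule.ideal_span_singleton_smul, smul_eq_mul, Ideal.mul_top])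

theorem isSMulRegular_quotient_iff {I : Ideal R} {h : R} :
    IsSMulRegular (R ⧸ I) h ↔ RegularMod h I := by
  rw [isSMulRegular_iff_right_eq_zero_of_smul, Ideal.Quotient.mk_surjective.forall]
  refine forall_congr' fun f => ?_
  rw [← Ideal.Quotient.eq_zero_iff_mem, ← Ideal.Quotient.eq_zero_iff_mem]
  rfl

theorem depthGE_of_isRegular {m : Ideal R} (rs : List R) (I : Ideal R) (hrs : ∀ f ∈ rs, f ∈ m)
    (h : RingTheory.Sequence.IsRegular (R ⧸ I) rs) : DepthGE m rs.length I := by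
  induction rs generalizing I with
  | nil => trivial
  | cons a rs ih =>
    rw [RingTheory.Sequence.isRegular_cons_iff] at h
    exact ⟨a, hrs a (by simp), isSMulRegular_quotient_iff.1 h.1,
      ih _ (fun f hf => hrs f (by simp [hf]))
        (((quotSMulTopQuotientEquiv I a).isRegular_congr rs).1 h.2)⟩

theorem DepthGE.exists_isRegular {m : Ideal R} (hm : m ≠ ⊤) {r : ℕ} {I : Ideal R} (hI : I ≤ m)
    (h : DepthGE m r I) : ∃ rs : List R, rs.length = r ∧ (∀ f ∈ rs, f ∈ m) ∧
      RingTheory.Sequence.IsRegular (R ⧸ I) rs := by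
  induction r generalizing I with
  | zero =>
    have : Nontrivial (R ⧸ I) := Ideal.Quotient.nontrivial_iff.2 (by
      rintro rfl
      exact hm (top_le_iff.1 hI))
    exact ⟨[], rfl, by simp, RingTheory.Sequence.IsRegular.nil _ _⟩
  | succ r ih =>
    obtain ⟨a, ham, ha, h⟩ := h
    obtain ⟨rs, h1, h2, h3⟩ := ih
      (sup_le hI ((Ideal.span_singleton_le_iff_mem m).2 ham)) h
    refine ⟨a :: rs, by simp [h1], by simpa [ham] using h2, ?_⟩
    rw [RingTheory.Sequence.isRegular_cons_iff]
    exact ⟨isSMulRegular_quotient_iff.2 ha,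
      ((quotSMulTopQuotientEquiv I a).isRegular_congr rs).2 h3⟩

end Depth

/-! ### Depth with respect to the graded maximal ideal -/

section PolynomialDepth

variable {K : Type*} [Field K] {n : ℕ}

variable (K n) in
/-- The ideal `(x_1, …, x_n)`. -/
noncomputable def irrelevant : Ideal (MvPolynomial (Fin n) K) :=
  Ideal.span (Set.range (X : Fin n → MvPolynomial (Fin n) K))

theorem mem_irrelevant {f : MvPolynomial (Fin n) K} :
    f ∈ irrelevant K n ↔ constantCoeff f = 0 := by
  rw [irrelevant, ← Set.image_univ, mem_ideal_span_X_image]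
  constructor
  · intro h
    by_contra hc
    obtain ⟨i, -, hi⟩ := h 0 (by rwa [mem_support_iff, ← constantCoeff_eq])
    simp at hi
  · intro h u hu
    by_contra! hc
    have : u = 0 := Finsupp.ext fun i => hc i (Set.mem_univ i)
    rw [this, mem_support_iff, ← constantCoeff_eq] at hu
    exact hu h

theorem irrelevant_eq_ker : irrelevant K n = RingHom.ker (constantCoeff : MvPolynomial (Fin n) K →+* K) :=
  Ideal.ext fun _ => mem_irrelevant

instance irrelevant_isMaximal : (irrelevant K n).IsMaximal := by
  rw [irrelevant_eq_ker]
  exact RingHom.ker_isMaximal_of_surjective _ fun a => ⟨C a, by simp⟩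

theorem le_quotientDepth_iff {I : Ideal (MvPolynomial (Fin n) K)} (hI : I ≤ irrelevant K n) (r : ℕ) :
    (r : ℕ∞) ≤ quotientDepth I ↔ DepthGE (irrelevant K n) r I := by
  constructor
  · intro h
    rcases Nat.eq_zero_or_pos r with rfl | hr
    · trivial
    by_contra hc
    have : quotientDepth I ≤ ((r - 1 : ℕ) : ℕ∞) := by
      refine iSup₂_le fun rs hrs => ?_
      rw [Nat.cast_le]
      by_contra hlt
      exact hc ((depthGE_of_isRegular rs I hrs.1 hrs.2).mono (by omega))
    have := h.trans this
    rw [Nat.cast_le] at this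
    omega
  · intro h
    obtain ⟨rs, h1, h2, h3⟩ := h.exists_isRegular (Ideal.IsPrime.ne_top inferInstance) hI
    rw [← h1]
    exact le_iSup₂ (f := fun (rs : List (MvPolynomial (Fin n) K)) (_ : (∀ f ∈ rs,
      f ∈ Ideal.span (Set.range (X : Fin n → MvPolynomial (Fin n) K))) ∧
      RingTheory.Sequence.IsRegular (MvPolynomial (Fin n) K ⧸ I) rs) => (rs.length : ℕ∞)) rs ⟨h2, h3⟩

theorem quotientDepth_eq_iff {I : Ideal (MvPolynomial (Fin n) K)} (hI : I ≤ irrelevant K n) (r : ℕ) :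
    quotientDepth I = r ↔
      DepthGE (irrelevant K n) r I ∧ ¬ DepthGE (irrelevant K n) (r + 1) I := by
  rw [← le_quotientDepth_iff hI, ← le_quotientDepth_iff hI, not_le]
  constructor
  · intro h
    rw [h]
    exact ⟨le_rfl, by exact_mod_cast Nat.lt_succ_self r⟩
  · rintro ⟨h1, h2⟩
    refine le_antisymm ?_ h1
    rw [Nat.cast_add, Nat.cast_one] at h2
    exact Order.le_of_lt_add_one h2

theorem linForm_mem_irrelevant (c : Fin n → K) : linForm c ∈ irrelevant K n := by
  rw [mem_irrelevant]
  simp [linForm]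

/-- Over an infinite field a regular element can be chosen to be a linear form. -/
theorem NoSocle.exists_regularMod_linForm [Infinite K] {I : Ideal (MvPolynomial (Fin n) K)}
    (h : NoSocle (irrelevant K n) I) : ∃ c, RegularMod (linForm c) I := by
  let L : (Fin n → K) →ₗ[K] MvPolynomial (Fin n) K :=
    { toFun := linForm
      map_add' := fun c d => by simp [linForm, add_mul, Finset.sum_add_distrib]
      map_smul' := fun a c => by simp [linForm, Finset.smul_sum, smul_eq_C_mul, mul_assoc] }
  have hfin := associatedPrimes.finite (MvPolynomial (Fin n) K) (MvPolynomial (Fin n) K ⧸ I)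
  -- The coefficient vectors whose linear form lies in a given associated prime form a proper
  -- subspace. Finitely many proper subspaces do not cover a vector space over an infinite field.
  let s : Finset (Submodule K (Fin n → K)) := by
    classical
    exact hfin.toFinset.image fun P => (P.restrictScalars K).comap L
  have hs : (⊤ : Submodule K (Fin n → K)) ∉ s := by
    classical
    intro htop
    obtain ⟨P, hP, hPtop⟩ := Finset.mem_image.1 htop
    rw [Set.Finite.mem_toFinset] at hP
    refine h.not_le_of_mem_associatedPrimes hP (Ideal.span_le.2 ?_)
    rintro _ ⟨i, rfl⟩
    have : (Pi.single i 1 : Fin n → K) ∈ (P.restrictScalars K).comap L := by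
      rw [hPtop]
      trivial
    rw [← linForm_single]
    exact this
  have h1 := Subspace.biUnion_ne_univ_of_top_notMem hs
  obtain ⟨c, hc⟩ := (Set.ne_univ_iff_exists_notMem _).1 h1
  simp only [Set.mem_iUnion, not_exists] at hc
  refine ⟨c, regularMod_of_notMem_associatedPrimes fun P hP hcP => ?_⟩
  classical
  exact hc _ (Finset.mem_image.2 ⟨P, hfin.mem_toFinset.2 hP, rfl⟩) hcP

end PolynomialDepth

/-! ### Hilbert functions of homogeneous ideals -/

section HilbertFunction

attribute [local instance] MvPolynomial.gradedAlgebra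

variable {K : Type*} [Field K] {n : ℕ}

/-- The forms of degree `q` in the ideal `I`. -/
noncomputable def idealPiece (I : Ideal (MvPolynomial (Fin n) K)) (q : ℕ) :
    Submodule K (MvPolynomial (Fin n) K) :=
  I.restrictScalars K ⊓ homogeneousSubmodule (Fin n) K q

theorem mem_idealPiece {I : Ideal (MvPolynomial (Fin n) K)} {q : ℕ} {f : MvPolynomial (Fin n) K} :
    f ∈ idealPiece I q ↔ f ∈ I ∧ f ∈ homogeneousSubmodule (Fin n) K q :=
  Iff.rfl

theorem idealPiece_le (I : Ideal (MvPolynomial (Fin n) K)) (q : ℕ) :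
    idealPiece I q ≤ homogeneousSubmodule (Fin n) K q :=
  inf_le_right

theorem hilbertFunction_eq_codim (I : Ideal (MvPolynomial (Fin n) K)) (q : ℕ) :
    hilbertFunction I q = codim q (idealPiece I q) := by
  let φ := (Ideal.Quotient.mkₐ K I).toLinearMap.domRestrict (homogeneousSubmodule (Fin n) K q)
  have h1 := φ.finrank_range_add_finrank_ker
  have h2 : LinearMap.range φ
      = (homogeneousSubmodule (Fin n) K q).map (Ideal.Quotient.mkₐ K I).toLinearMap := by
    rw [LinearMap.range_domRestrict]
  have h3 : (LinearMap.ker φ).map (homogeneousSubmodule (Fin n) K q).subtype = idealPiece I q := by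
    ext f
    constructor
    · rintro ⟨g, hg, rfl⟩
      exact ⟨Ideal.Quotient.eq_zero_iff_mem.1 hg, g.2⟩
    · rintro ⟨hf, hfq⟩
      exact ⟨⟨f, hfq⟩, Ideal.Quotient.eq_zero_iff_mem.2 hf, rfl⟩
  have h4 := (Submodule.equivMapOfInjective (homogeneousSubmodule (Fin n) K q).subtype
    Subtype.val_injective (LinearMap.ker φ)).finrank_eq
  rw [h3] at h4
  rw [h2, h4] at h1
  rw [hilbertFunction, codim]
  omega

theorem IsHomogeneousIdeal.component_mem {I : Ideal (MvPolynomial (Fin n) K)}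
    (hI : IsHomogeneousIdeal I) {f : MvPolynomial (Fin n) K} (hf : f ∈ I) (q : ℕ) :
    homogeneousComponent q f ∈ I :=
  homogeneousComponent_mem_of_mem hI hf q

theorem isHomogeneousIdeal_span {s : Set (MvPolynomial (Fin n) K)}
    (hs : ∀ f ∈ s, ∃ q, f.IsHomogeneous q) : IsHomogeneousIdeal (Ideal.span s) :=
  Ideal.homogeneous_span _ _ hs

theorem IsHomogeneousIdeal.sup_linForm {I : Ideal (MvPolynomial (Fin n) K)}
    (hI : IsHomogeneousIdeal I) (c : Fin n → K) :
    IsHomogeneousIdeal (I ⊔ Ideal.span {linForm c}) :=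
  Ideal.IsHomogeneous.sup hI (isHomogeneousIdeal_span (by
    rintro f rfl
    exact ⟨1, linForm_isHomogeneous c⟩))

theorem homogeneousComponent_linForm_mul (c : Fin n → K) (f : MvPolynomial (Fin n) K) (q : ℕ) :
    homogeneousComponent (q + 1) (linForm c * f) = linForm c * homogeneousComponent q f := by
  conv_lhs => rw [← sum_homogeneousComponent f]
  rw [Finset.mul_sum, map_sum]
  have : ∀ i, homogeneousComponent (q + 1) (linForm c * homogeneousComponent i f)
      = if i = q then linForm c * homogeneousComponent i f else 0 := by
    intro i
    have h := (linForm_isHomogeneous c).mul (homogeneousComponent_isHomogeneous i f)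
    rw [homogeneousComponent_of_mem ((mem_homogeneousSubmodule _ _).2 h)]
    congr 1
    simp only [eq_iff_iff]
    omega
  simp only [this, Finset.sum_ite_eq', Finset.mem_range]
  split_ifs with h
  · rfl
  · rw [homogeneousComponent_eq_zero _ _ (by omega), mul_zero]

/-- The codimension formula in a single degree: regularity identifies the colon space with the piece
of I in degree q, and homogeneity identifies the sum with the piece of the enlarged ideal. -/
theorem hilbertFunction_succ {I : Ideal (MvPolynomial (Fin n) K)} (hI : IsHomogeneousIdeal I)
    {c : Fin n → K} (hc : RegularMod (linForm c) I) (q : ℕ) :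
    hilbertFunction I (q + 1)
      = hilbertFunction (I ⊔ Ideal.span {linForm c}) (q + 1) + hilbertFunction I q := by
  rw [hilbertFunction_eq_codim, hilbertFunction_eq_codim, hilbertFunction_eq_codim,
    codim_eq_add (idealPiece_le I (q + 1)) c]
  congr 2
  · refine le_antisymm (sup_le (fun f hf => ⟨Submodule.mem_sup_left hf.1, hf.2⟩) ?_) ?_
    · intro f hf
      refine ⟨?_, linMul_le c q hf⟩
      obtain ⟨g, -, rfl⟩ := hf
      exact Submodule.mem_sup_right (Ideal.mul_mem_right _ _ (Ideal.mem_span_singleton_self _))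
    · rintro f ⟨hf, hfq⟩
      obtain ⟨g, hg⟩ := mem_sup_span_singleton.1 hf
      have h1 := hI.component_mem hg (q + 1)
      rw [map_sub, homogeneousComponent_linForm_mul,
        homogeneousComponent_of_mem hfq, if_pos rfl] at h1
      have h2 : linForm c * homogeneousComponent q g ∈ linMul c q :=
        ⟨_, homogeneousComponent_mem _ _, rfl⟩
      have h3 : f - linForm c * homogeneousComponent q g ∈ idealPiece I (q + 1) :=
        ⟨h1, Submodule.sub_mem _ hfq (linMul_le c q h2)⟩
      have := Submodule.add_mem_sup h3 h2
      rwa [sub_add_cancel] at this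
  · refine le_antisymm (fun f hf => ⟨hc f hf.1.1, hf.2⟩) fun f hf => ⟨⟨I.mul_mem_left _ hf.1, ?_⟩, hf.2⟩
    exact linMul_le c q ⟨f, hf.2, rfl⟩

theorem idealPiece_zero {I : Ideal (MvPolynomial (Fin n) K)} (hI : I ≤ irrelevant K n) :
    idealPiece I 0 = ⊥ := by
  rw [eq_bot_iff]
  rintro f ⟨hf, hf0⟩
  have h1 := homogeneousComponent_of_mem (m := 0) hf0
  rw [if_pos rfl, homogeneousComponent_zero, ← constantCoeff_eq, mem_irrelevant.1 (hI hf),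
    map_zero] at h1
  exact h1.symm

theorem hilbertFunction_zero {I : Ideal (MvPolynomial (Fin n) K)} (hI : I ≤ irrelevant K n) :
    hilbertFunction I 0 = 1 := by
  rw [hilbertFunction_eq_codim, idealPiece_zero hI, codim, finrank_bot, homogeneousSubmodule_zero]
  rw [show (1 : Submodule K (MvPolynomial (Fin n) K)) = K ∙ 1 from Submodule.one_eq_span]
  rw [finrank_span_singleton one_ne_zero]

theorem IsHomogeneousIdeal.le_irrelevant {I : Ideal (MvPolynomial (Fin n) K)}
    (hI : IsHomogeneousIdeal I) (h0 : hilbertFunction I 0 ≠ 0) : I ≤ irrelevant K n := by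
  intro f hf
  rw [mem_irrelevant]
  by_contra hc
  have h1 := hI.component_mem hf 0
  rw [homogeneousComponent_zero, ← constantCoeff_eq] at h1
  have htop : I = ⊤ := by
    rw [Ideal.eq_top_iff_one]
    have := I.mul_mem_left (C (constantCoeff f)⁻¹) h1
    rwa [← C_mul, inv_mul_cancel₀ hc, C_1] at this
  apply h0
  rw [hilbertFunction_eq_codim, codim, htop]
  have : idealPiece (⊤ : Ideal (MvPolynomial (Fin n) K)) 0 = homogeneousSubmodule (Fin n) K 0 :=
    le_antisymm (idealPiece_le _ _) fun f hf => ⟨trivial, hf⟩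
  rw [this, Nat.sub_self]

theorem X_mul_mem_idealPiece {I : Ideal (MvPolynomial (Fin n) K)} {q : ℕ} (i : Fin n)
    {f : MvPolynomial (Fin n) K} (hf : f ∈ idealPiece I q) : X i * f ∈ idealPiece I (q + 1) := by
  refine ⟨I.mul_mem_left _ hf.1, ?_⟩
  have := (isHomogeneous_X K i).mul ((mem_homogeneousSubmodule _ _).1 hf.2)
  rwa [add_comm] at this

/-- Macaulay's theorem. -/
theorem hilbertFunction_succ_le [Infinite K] (I : Ideal (MvPolynomial (Fin n) K)) {q : ℕ}
    (hq : 1 ≤ q) : hilbertFunction I (q + 1) ≤ macaulayPow (hilbertFunction I q) q := by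
  obtain ⟨q, rfl⟩ : ∃ p, q = p + 1 := ⟨q - 1, by omega⟩
  rw [hilbertFunction_eq_codim, hilbertFunction_eq_codim]
  exact codim_le_macaulayPow (idealPiece_le _ _) (idealPiece_le _ _)
    fun i f hf => X_mul_mem_idealPiece i hf

/-- An ideal whose Hilbert function attains the bound of Green's theorem everywhere has positive
depth. -/
theorem noSocle_of_greenPow_add_le [Infinite K] {I : Ideal (MvPolynomial (Fin n) K)}
    (hI : IsHomogeneousIdeal I) (h : ∀ q, greenPow (hilbertFunction I (q + 1)) (q + 1)
      + hilbertFunction I q ≤ hilbertFunction I (q + 1)) : NoSocle (irrelevant K n) I := by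
  intro z hz
  by_contra! hc
  obtain ⟨q, hq⟩ : ∃ q, homogeneousComponent q z ∉ I := by
    by_contra! hall
    exact hz ((mem_iff_homogeneousComponent_mem hI z).2 hall)
  have hq' := h q
  rw [hilbertFunction_eq_codim, hilbertFunction_eq_codim] at hq'
  -- The linear form may depend on q. That is harmless, since a socle element is killed by every
  -- linear form.
  obtain ⟨c, hcU⟩ := exists_linColon_eq (idealPiece_le I q) (idealPiece_le I (q + 1))
    (fun i f hf => X_mul_mem_idealPiece i hf) hq'
  have hmem : homogeneousComponent q z ∈ linColon c q (idealPiece I (q + 1)) := by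
    have h1 := hI.component_mem (hc _ (linForm_mem_irrelevant c)) (q + 1)
    rw [homogeneousComponent_linForm_mul] at h1
    exact ⟨⟨h1, linMul_le c q ⟨_, homogeneousComponent_mem _ _, rfl⟩⟩, homogeneousComponent_mem _ _⟩
  rw [← hcU] at hmem
  exact hq hmem.1

end HilbertFunction

/-! ### Extension of the base field -/

section BaseChange

variable {K L σ : Type*} [Field K] [Field L] [Algebra K L]

/-- Apply a linear form to the coefficients of a polynomial. -/
noncomputable def coeffMap (φ : L →ₗ[K] K) (f : MvPolynomial σ L) : MvPolynomial σ K :=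
  ∑ u ∈ f.support, monomial u (φ (coeff u f))

theorem coeff_coeffMap (φ : L →ₗ[K] K) (f : MvPolynomial σ L) (u : σ →₀ ℕ) :
    coeff u (coeffMap φ f) = φ (coeff u f) := by
  classical
  rw [coeffMap, coeff_sum]
  simp only [coeff_monomial, Finset.sum_ite_eq', mem_support_iff]
  split_ifs with h
  · rfl
  · rw [not_not.1 h, map_zero]

theorem coeffMap_zero (φ : L →ₗ[K] K) : coeffMap φ (0 : MvPolynomial σ L) = 0 := by
  ext u; simp [coeff_coeffMap]

theorem coeffMap_add (φ : L →ₗ[K] K) (f g : MvPolynomial σ L) :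
    coeffMap φ (f + g) = coeffMap φ f + coeffMap φ g := by
  ext u; simp [coeff_coeffMap]

theorem coeffMap_sum {ι : Type*} (φ : L →ₗ[K] K) (s : Finset ι) (f : ι → MvPolynomial σ L) :
    coeffMap φ (∑ i ∈ s, f i) = ∑ i ∈ s, coeffMap φ (f i) := by
  ext u; simp [coeff_coeffMap, coeff_sum]

theorem coeffMap_map_mul (φ : L →ₗ[K] K) (h : MvPolynomial σ K) (f : MvPolynomial σ L) :
    coeffMap φ (map (algebraMap K L) h * f) = h * coeffMap φ f := by
  classical
  ext u
  rw [coeff_coeffMap, coeff_mul, coeff_mul, map_sum]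
  refine Finset.sum_congr rfl fun p _ => ?_
  rw [coeff_map, coeff_coeffMap, ← Algebra.smul_def, map_smul, smul_eq_mul]

theorem coeffMap_smul_map (φ : L →ₗ[K] K) (a : L) (h : MvPolynomial σ K) :
    coeffMap φ (a • map (algebraMap K L) h) = φ a • h := by
  ext u
  rw [coeff_coeffMap, coeff_smul, coeff_smul, coeff_map, smul_eq_mul, mul_comm,
    ← Algebra.smul_def, map_smul, smul_eq_mul, smul_eq_mul, mul_comm]

theorem IsHomogeneous.coeffMap {f : MvPolynomial σ L} {q : ℕ} (hf : f.IsHomogeneous q)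
    (φ : L →ₗ[K] K) : (coeffMap φ f).IsHomogeneous q := by
  intro u hu
  refine hf fun h => hu ?_
  rw [coeff_coeffMap, h, map_zero]

theorem homogeneousComponent_coeffMap (φ : L →ₗ[K] K) (f : MvPolynomial σ L) (q : ℕ) :
    homogeneousComponent q (coeffMap φ f) = coeffMap φ (homogeneousComponent q f) := by
  ext u
  rw [coeff_coeffMap, coeff_homogeneousComponent, coeff_homogeneousComponent, coeff_coeffMap]
  split_ifs <;> simp

/-- The extension of an ideal of `K[x]` to `L[x]`. -/
noncomputable def extend (L : Type*) [Field L] [Algebra K L] (I : Ideal (MvPolynomial σ K)) :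
    Ideal (MvPolynomial σ L) :=
  I.map (map (algebraMap K L))

theorem exists_eq_sum_smul_map (f : MvPolynomial σ L) :
    ∃ (ι : Set L) (s : Finset ι) (b : ι → L) (φ : ι → L →ₗ[K] K),
      f = ∑ j ∈ s, b j • map (algebraMap K L) (coeffMap (φ j) f) := by
  classical
  let b := Module.Basis.ofVectorSpace K L
  refine ⟨_, f.support.biUnion fun u => (b.repr (coeff u f)).support, b, b.coord, ?_⟩
  ext u
  rw [coeff_sum]
  conv_lhs => rw [← b.linearCombination_repr (coeff u f)]
  rw [Finsupp.linearCombination_apply, Finsupp.sum_of_support_subset _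
    (s := f.support.biUnion fun u => (b.repr (coeff u f)).support)]
  · refine Finset.sum_congr rfl fun j _ => ?_
    rw [coeff_smul, coeff_map, coeff_coeffMap, smul_eq_mul, Algebra.smul_def, mul_comm]
    rfl
  · by_cases hu : u ∈ f.support
    · exact Finset.subset_biUnion_of_mem (fun u => (b.repr (coeff u f)).support) hu
    · rw [notMem_support_iff.1 hu]
      simp
  · simp

/-- Applying a functional to the coefficients is K[x]-linear, and expanding the coefficients in a
K-basis of L recovers f from finitely many such images. All descent statements below follow from
this test. -/
theorem mem_extend_iff {I : Ideal (MvPolynomial σ K)} {f : MvPolynomial σ L} :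
    f ∈ extend L I ↔ ∀ φ : L →ₗ[K] K, coeffMap φ f ∈ I := by
  constructor
  · intro hf φ
    refine Submodule.closure_induction (p := fun f _ => coeffMap φ f ∈ I) ?_ ?_ ?_ hf
    · rw [coeffMap_zero]
      exact I.zero_mem
    · intro x y _ _ hx hy
      rw [coeffMap_add]
      exact I.add_mem hx hy
    · rintro r _ ⟨g, hg, rfl⟩
      rw [smul_eq_mul, mul_comm]
      erw [coeffMap_map_mul]
      exact I.mul_mem_right _ hg
  · intro h
    obtain ⟨ι, s, b, φ, hf⟩ := exists_eq_sum_smul_map (K := K) f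
    rw [hf]
    refine Ideal.sum_mem _ fun j _ => ?_
    rw [smul_eq_C_mul]
    exact Ideal.mul_mem_left _ _ (Ideal.mem_map_of_mem _ (h _))

theorem map_mem_extend_iff {I : Ideal (MvPolynomial σ K)} {f : MvPolynomial σ K} :
    map (algebraMap K L) f ∈ extend L I ↔ f ∈ I := by
  refine ⟨fun h => ?_, fun h => Ideal.mem_map_of_mem _ h⟩
  -- A K-linear retraction of L onto K, so that φ(1) = 1 and the original polynomial is recovered.
  obtain ⟨φ, hφ⟩ := LinearMap.exists_leftInverse_of_injective (Algebra.linearMap K L)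
    (LinearMap.ker_eq_bot.2 (algebraMap K L).injective)
  have h1 := mem_extend_iff.1 h φ
  have h2 := coeffMap_smul_map φ (1 : L) f
  rw [one_smul] at h2
  have h3 : φ 1 = 1 := by simpa using LinearMap.congr_fun hφ 1
  rwa [h2, h3, one_smul] at h1

theorem RegularMod.extend {I : Ideal (MvPolynomial σ K)} {h : MvPolynomial σ K}
    (hh : RegularMod h I) : RegularMod (map (algebraMap K L) h) (extend L I) := by
  intro f hf
  rw [mem_extend_iff] at hf ⊢
  intro φ
  have := hf φ
  rw [coeffMap_map_mul] at this
  exact hh _ this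

theorem extend_sup_span_singleton (I : Ideal (MvPolynomial σ K)) (h : MvPolynomial σ K) :
    extend L (I ⊔ Ideal.span {h}) = extend L I ⊔ Ideal.span {map (algebraMap K L) h} := by
  rw [extend, Ideal.map_sup, Ideal.map_span, Set.image_singleton]
  rfl

variable {n : ℕ}

theorem map_mem_irrelevant {f : MvPolynomial (Fin n) K} (hf : f ∈ irrelevant K n) :
    map (algebraMap K L) f ∈ irrelevant L n := by
  rw [mem_irrelevant] at hf ⊢
  rw [constantCoeff_map, hf, map_zero]

theorem extend_le_irrelevant {I : Ideal (MvPolynomial (Fin n) K)} (hI : I ≤ irrelevant K n) :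
    extend L I ≤ irrelevant L n :=
  Ideal.map_le_iff_le_comap.2 fun _ hf => map_mem_irrelevant (hI hf)

theorem NoSocle.of_extend {I : Ideal (MvPolynomial (Fin n) K)}
    (h : NoSocle (irrelevant L n) (extend L I)) : NoSocle (irrelevant K n) I := by
  intro z hz
  obtain ⟨a, ha, haz⟩ := h _ (mt map_mem_extend_iff.1 hz)
  rw [mem_extend_iff, not_forall] at haz
  obtain ⟨φ, hφ⟩ := haz
  refine ⟨coeffMap φ a, ?_, ?_⟩
  · rw [mem_irrelevant] at ha ⊢
    rw [constantCoeff_eq] at ha ⊢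
    rw [coeff_coeffMap, ha, map_zero]
  · rwa [mul_comm, coeffMap_map_mul, mul_comm] at hφ

/-- In either direction a regular element defined over K is found; it stays regular over L, and by
Rees's theorem both depths may be computed by dividing by it. -/
theorem depthGE_extend_iff {I : Ideal (MvPolynomial (Fin n) K)} {r : ℕ} :
    DepthGE (irrelevant L n) r (extend L I) ↔ DepthGE (irrelevant K n) r I := by
  induction r generalizing I with
  | zero => exact Iff.rfl
  | succ r ih =>
    have key : ∀ h ∈ irrelevant K n, RegularMod h I →
        (DepthGE (irrelevant L n) (r + 1) (extend L I) ↔ DepthGE (irrelevant K n) (r + 1) I) := by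
      intro h hm hh
      rw [depthGE_succ_iff hm hh, depthGE_succ_iff (map_mem_irrelevant hm) hh.extend,
        ← extend_sup_span_singleton, ih]
    constructor
    · intro h'
      obtain ⟨h, hm, hh⟩ := h'.noSocle.of_extend.exists_regularMod
      exact (key h hm hh).1 h'
    · intro h'
      obtain ⟨h, hm, hh, -⟩ := id h'
      exact (key h hm hh).2 h'

section

attribute [local instance] MvPolynomial.gradedAlgebra

theorem isHomogeneousIdeal_of_component_mem {I : Ideal (MvPolynomial (Fin n) K)}
    (h : ∀ f ∈ I, ∀ q, homogeneousComponent q f ∈ I) : IsHomogeneousIdeal I :=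
  fun q f hf => by
    have := h f hf q
    rwa [← decomposition.decompose'_apply] at this

theorem IsHomogeneousIdeal.extend {I : Ideal (MvPolynomial (Fin n) K)}
    (hI : IsHomogeneousIdeal I) : IsHomogeneousIdeal (extend L I) := by
  refine isHomogeneousIdeal_of_component_mem fun f hf q => ?_
  rw [mem_extend_iff] at hf ⊢
  intro φ
  rw [← homogeneousComponent_coeffMap]
  exact hI.component_mem (hf φ) q

end

theorem finrank_idealPiece_extend (I : Ideal (MvPolynomial (Fin n) K)) (q : ℕ) :
    Module.finrank L (idealPiece (extend L I) q) = Module.finrank K (idealPiece I q) := by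
  have : Module.Finite K (idealPiece I q) :=
    Submodule.finiteDimensional_of_le (idealPiece_le I q)
  let b := Module.finBasis K (idealPiece I q)
  let v : Fin (Module.finrank K (idealPiece I q)) → MvPolynomial (Fin n) L :=
    fun i => map (algebraMap K L) (b i : MvPolynomial (Fin n) K)
  have hli : LinearIndependent L v := by
    rw [Fintype.linearIndependent_iff]
    intro c hc i
    rw [← Module.forall_dual_apply_eq_zero_iff K]
    intro φ
    have h1 := congrArg (coeffMap φ) hc
    rw [coeffMap_sum, coeffMap_zero] at h1
    simp only [v, coeffMap_smul_map] at h1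
    have h2 := b.linearIndependent.map' (idealPiece I q).subtype (Submodule.ker_subtype _)
    exact Fintype.linearIndependent_iff.1 h2 (fun i => φ (c i)) h1 i
  have hspan : Submodule.span L (Set.range v) = idealPiece (extend L I) q := by
    apply le_antisymm
    · rw [Submodule.span_le]
      rintro _ ⟨i, rfl⟩
      refine mem_idealPiece.2 ⟨map_mem_extend_iff.2 (b i).2.1, ?_⟩
      exact (mem_homogeneousSubmodule _ _).2
        (((mem_homogeneousSubmodule _ _).1 (b i).2.2).map _)
    · rintro f ⟨hf, hfq⟩
      obtain ⟨ι, s, a, φ, hfs⟩ := exists_eq_sum_smul_map (K := K) f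
      rw [hfs]
      refine Submodule.sum_mem _ fun j _ => Submodule.smul_mem _ _ ?_
      have hmem : coeffMap (φ j) f ∈ idealPiece I q :=
        ⟨mem_extend_iff.1 hf _, (mem_homogeneousSubmodule _ _).2
          (IsHomogeneous.coeffMap ((mem_homogeneousSubmodule _ _).1 hfq) _)⟩
      have h1 := congrArg (Subtype.val) (b.sum_repr ⟨_, hmem⟩)
      simp only [Submodule.coe_sum, Submodule.coe_smul] at h1
      rw [← h1, map_sum]
      refine Submodule.sum_mem _ fun i _ => ?_
      rw [smul_eq_C_mul, map_mul, map_C, ← smul_eq_C_mul]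
      exact Submodule.smul_mem _ _ (Submodule.subset_span ⟨i, rfl⟩)
  rw [← hspan, finrank_span_eq_card hli, Fintype.card_fin]

theorem idealPiece_top (q : ℕ) :
    idealPiece (⊤ : Ideal (MvPolynomial (Fin n) K)) q = homogeneousSubmodule (Fin n) K q :=
  le_antisymm (idealPiece_le _ _) fun _ hf => ⟨trivial, hf⟩

theorem hilbertFunction_extend (I : Ideal (MvPolynomial (Fin n) K)) :
    hilbertFunction (extend L I) = hilbertFunction I := by
  funext q
  rw [hilbertFunction_eq_codim, hilbertFunction_eq_codim, codim, codim, finrank_idealPiece_extend]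
  have htop : extend L (⊤ : Ideal (MvPolynomial (Fin n) K)) = ⊤ := Ideal.map_top _
  rw [← idealPiece_top, ← idealPiece_top, ← htop, finrank_idealPiece_extend]

end BaseChange

/-! ### Monomial ideals as upper sets of exponents -/

section MonomialIdeals

/-- The exponent of a monomial in `n` variables, as an exponent in countably many variables. -/
noncomputable def emb {n : ℕ} (u : Fin n →₀ ℕ) : ℕ →₀ ℕ := u.embDomain Fin.valEmbedding

variable {n : ℕ}

theorem emb_apply (u : Fin n →₀ ℕ) (i : Fin n) : emb u i = u i :=
  Finsupp.embDomain_apply_self Fin.valEmbedding u i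

theorem emb_of_le (u : Fin n →₀ ℕ) {j : ℕ} (h : n ≤ j) : emb u j = 0 :=
  Finsupp.embDomain_of_notMem_range _ _ _ (by rintro ⟨i, rfl⟩; exact absurd i.2 (not_lt.2 h))

theorem emb_add (u v : Fin n →₀ ℕ) : emb (u + v) = emb u + emb v :=
  Finsupp.embDomain_add _ _ _

theorem emb_single (i : Fin n) (a : ℕ) : emb (Finsupp.single i a) = Finsupp.single (i : ℕ) a :=
  Finsupp.embDomain_single _ _ _

theorem emb_injective : Function.Injective (emb (n := n)) :=
  Finsupp.embDomain_injective _

theorem exists_emb_eq {w : ℕ →₀ ℕ} (hw : ∀ j, n ≤ j → w j = 0) : ∃ u : Fin n →₀ ℕ, emb u = w := by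
  refine ⟨Finsupp.equivFunOnFinite.symm fun i => w i, ?_⟩
  ext j
  by_cases h : j < n
  · exact emb_apply _ ⟨j, h⟩
  · rw [emb_of_le _ (not_lt.1 h), hw j (not_lt.1 h)]

theorem degree_emb (u : Fin n →₀ ℕ) : (emb u).degree = u.degree := by
  rw [Finsupp.degree_apply, Finsupp.degree_apply, emb, Finsupp.support_embDomain, Finset.sum_map]
  exact Finset.sum_congr rfl fun i _ => emb_apply u i

theorem emb_le_emb {u v : Fin n →₀ ℕ} : emb u ≤ emb v ↔ u ≤ v := by
  constructor
  · intro h i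
    have := h i
    rwa [emb_apply, emb_apply] at this
  · intro h
    rw [← add_tsub_cancel_of_le h, emb_add]
    exact le_self_add

theorem emb_lex_lt {u v : Fin n →₀ ℕ} : toLex (emb u) < toLex (emb v) ↔ toLex u < toLex v := by
  rw [Finsupp.Lex.lt_iff, Finsupp.Lex.lt_iff]
  simp only [ofLex_toLex]
  constructor
  · rintro ⟨i, h1, h2⟩
    have hi : i < n := by
      by_contra h
      rw [emb_of_le _ (not_lt.1 h), emb_of_le _ (not_lt.1 h)] at h2
      exact lt_irrefl _ h2
    refine ⟨⟨i, hi⟩, fun j hj => ?_, ?_⟩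
    · rw [← emb_apply, ← emb_apply]
      exact h1 j hj
    · rw [← emb_apply, ← emb_apply]
      exact h2
  · rintro ⟨i, h1, h2⟩
    refine ⟨i, fun j hj => ?_, ?_⟩
    · have := h1 ⟨j, hj.trans i.2⟩ hj
      rwa [← emb_apply, ← emb_apply] at this
    · rwa [emb_apply, emb_apply]

theorem emb_mapDomain_castAdd (u : Fin n →₀ ℕ) (m : ℕ) :
    emb (u.mapDomain (Fin.castAdd m)) = emb u := by
  induction u using Finsupp.induction_linear with
  | zero => simp [emb]
  | add f g hf hg => rw [Finsupp.mapDomain_add, emb_add, emb_add, hf, hg]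
  | single i a => rw [Finsupp.mapDomain_single, emb_single, emb_single, Fin.val_castAdd]

variable (K : Type*) [Field K]

/-- The monomial ideal of `K[x_1, …, x_n]` spanned by the monomials with exponents in `S`. -/
noncomputable def monoIdeal (n : ℕ) (S : Set (ℕ →₀ ℕ)) : Ideal (MvPolynomial (Fin n) K) :=
  Ideal.span ((fun u => monomial u (1 : K)) '' {u | emb u ∈ S})

variable {K} {S : Set (ℕ →₀ ℕ)}

theorem mem_monoIdeal (hup : IsUpperSet S) {f : MvPolynomial (Fin n) K} :
    f ∈ monoIdeal K n S ↔ ∀ u ∈ f.support, emb u ∈ S := by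
  rw [monoIdeal, mem_ideal_span_monomial_image]
  refine forall₂_congr fun u _ => ⟨?_, fun h => ⟨u, h, le_rfl⟩⟩
  rintro ⟨v, hv, hle⟩
  exact hup (emb_le_emb.2 hle) hv

theorem monomial_mem_monoIdeal (hup : IsUpperSet S) {u : Fin n →₀ ℕ} :
    monomial u (1 : K) ∈ monoIdeal K n S ↔ emb u ∈ S := by
  classical
  rw [mem_monoIdeal hup, support_monomial, if_neg one_ne_zero]
  simp

theorem monoIdeal_le_irrelevant (h0 : (0 : ℕ →₀ ℕ) ∉ S) : monoIdeal K n S ≤ irrelevant K n := by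
  rw [monoIdeal, Ideal.span_le]
  rintro _ ⟨u, hu, rfl⟩
  refine mem_irrelevant.2 ?_
  rw [constantCoeff_eq, coeff_monomial, if_neg]
  rintro rfl
  exact h0 (by simpa [emb] using hu)

theorem isHomogeneousIdeal_monoIdeal : IsHomogeneousIdeal (monoIdeal K n S) := by
  refine isHomogeneousIdeal_span ?_
  rintro _ ⟨u, -, rfl⟩
  exact ⟨u.degree, isHomogeneous_monomial 1 rfl⟩

/-- Exponents in countably many variables allow the same S to describe the ideal and all its
extensions to more variables. -/
theorem IsMonomialIdeal.exists_eq_monoIdeal {I : Ideal (MvPolynomial (Fin n) K)}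
    (hI : IsMonomialIdeal I) :
    ∃ S : Set (ℕ →₀ ℕ), IsUpperSet S ∧ DeterminedBelow n S ∧ I = monoIdeal K n S := by
  obtain ⟨T, rfl⟩ := hI
  have hle : ∀ w : ℕ →₀ ℕ, w.filter (· < n) ≤ w := by
    intro w j
    rw [Finsupp.filter_apply]
    split_ifs <;> simp
  refine ⟨{w | ∃ u ∈ T, emb u ≤ w}, ?_, ?_, ?_⟩
  · rintro a b hab ⟨u, hu, h⟩
    exact ⟨u, hu, h.trans hab⟩
  · intro w
    refine ⟨?_, fun ⟨u, hu, h⟩ => ⟨u, hu, h.trans (hle w)⟩⟩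
    rintro ⟨u, hu, h⟩
    refine ⟨u, hu, fun j => ?_⟩
    rw [Finsupp.filter_apply]
    split_ifs with hj
    · exact h j
    · rw [emb_of_le _ (not_lt.1 hj)]
  · ext f
    rw [mem_ideal_span_monomial_image, monoIdeal, mem_ideal_span_monomial_image]
    refine forall₂_congr fun v _ => ⟨fun ⟨u, hu, h⟩ => ⟨u, ⟨u, hu, le_rfl⟩, h⟩, ?_⟩
    rintro ⟨x, ⟨u, hu, h⟩, hx⟩
    exact ⟨u, hu, (emb_le_emb.1 h).trans hx⟩

theorem isLexsegment_monoIdeal_iff (hup : IsUpperSet S) :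
    IsLexsegment (monoIdeal K n S) ↔ LexBelow n S := by
  constructor
  · rintro ⟨-, h⟩ u v hu hv hd huS hlt
    obtain ⟨u, rfl⟩ := exists_emb_eq hu
    obtain ⟨v, rfl⟩ := exists_emb_eq hv
    rw [degree_emb, degree_emb] at hd
    rw [emb_lex_lt] at hlt
    rw [← monomial_mem_monoIdeal (K := K) hup] at huS ⊢
    exact h u v huS hd hlt
  · intro h
    refine ⟨⟨_, rfl⟩, fun u v hu hd hlt => ?_⟩
    rw [monomial_mem_monoIdeal hup] at hu ⊢
    exact h _ _ (fun j hj => emb_of_le u hj) (fun j hj => emb_of_le v hj)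
      (by rw [degree_emb, degree_emb, hd]) hu (emb_lex_lt.2 hlt)

theorem map_monoIdeal (hdet : DeterminedBelow n S) (m : ℕ) :
    (monoIdeal K n S).map (rename (Fin.castAdd m) :
      MvPolynomial (Fin n) K →ₐ[K] MvPolynomial (Fin (n + m)) K) = monoIdeal K (n + m) S := by
  rw [monoIdeal, Ideal.map_span]
  apply le_antisymm
  · rw [Ideal.span_le]
    rintro _ ⟨_, ⟨u, hu, rfl⟩, rfl⟩
    refine Ideal.subset_span ⟨u.mapDomain (Fin.castAdd m), ?_, (rename_monomial _ _ _).symm⟩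
    rw [Set.mem_ofPred_eq, emb_mapDomain_castAdd]
    exact hu
  · rw [monoIdeal, Ideal.span_le]
    rintro _ ⟨v, hv, rfl⟩
    have hv' := (hdet _).1 hv
    obtain ⟨u, hu⟩ := exists_emb_eq (n := n) (w := (emb v).filter (· < n))
      fun j hj => filter_lt_apply_of_le _ hj
    have hle : u.mapDomain (Fin.castAdd m) ≤ v := by
      rw [← emb_le_emb, emb_mapDomain_castAdd, hu]
      intro j
      rw [Finsupp.filter_apply]
      split_ifs <;> simp
    rw [← add_tsub_cancel_of_le hle]
    have hmul : monomial (u.mapDomain (Fin.castAdd m) + (v - u.mapDomain (Fin.castAdd m))) (1 : K)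
        = monomial (v - u.mapDomain (Fin.castAdd m)) 1 * rename (Fin.castAdd m) (monomial u 1) := by
      rw [rename_monomial, monomial_mul, one_mul, add_comm (v - _)]
    simp only [hmul]
    refine Ideal.mul_mem_left _ _ (Ideal.subset_span ⟨_, ⟨u, ?_, rfl⟩, rfl⟩)
    rw [Set.mem_ofPred_eq, hu]
    exact hv'

theorem isUniversalLexsegment_monoIdeal_iff (hup : IsUpperSet S) (hdet : DeterminedBelow n S) :
    IsUniversalLexsegment (monoIdeal K n S) ↔ LexAll S := by
  constructor
  · rintro ⟨-, h⟩ u v hd hu hlt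
    -- Enough additional variables to contain the supports of both exponents.
    let m := (u.support ∪ v.support).sup id + 1
    have key : ∀ j, n + m ≤ j → j ∉ u.support ∪ v.support := by
      intro j hj hmem
      have := Finset.le_sup (f := id) hmem
      simp only [id, m] at this hj
      omega
    have h1 := h m (by omega)
    rw [map_monoIdeal hdet, isLexsegment_monoIdeal_iff hup] at h1
    refine h1 u v (fun j hj => ?_) (fun j hj => ?_) hd hu hlt
    · by_contra h'
      exact key j hj (Finset.mem_union_left _ (Finsupp.mem_support_iff.2 h'))
    · by_contra h'
      exact key j hj (Finset.mem_union_right _ (Finsupp.mem_support_iff.2 h'))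
  · intro h
    refine ⟨(isLexsegment_monoIdeal_iff hup).2 (h.lexBelow _), fun m _ => ?_⟩
    rw [map_monoIdeal hdet, isLexsegment_monoIdeal_iff hup]
    exact h.lexBelow _

theorem regularMod_X_monoIdeal (hup : IsUpperSet S) {j : Fin n}
    (h : ∀ w : ℕ →₀ ℕ, w + Finsupp.single (j : ℕ) 1 ∈ S → w ∈ S) :
    RegularMod (X j) (monoIdeal K n S) := by
  intro f hf
  rw [mem_monoIdeal hup] at hf ⊢
  intro u hu
  refine h _ ?_
  rw [← emb_single, ← emb_add, add_comm]
  refine hf _ ?_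
  rw [mem_support_iff] at hu ⊢
  rwa [coeff_X_mul]

theorem monoIdeal_sup_span_X (j : Fin n) :
    monoIdeal K n S ⊔ Ideal.span {X j} = monoIdeal K n (S ∪ {u | u (j : ℕ) ≠ 0}) := by
  apply le_antisymm
  · refine sup_le (Ideal.span_mono (Set.image_mono fun u hu => Or.inl hu)) ?_
    rw [Ideal.span_le, Set.singleton_subset_iff]
    refine Ideal.subset_span ⟨Finsupp.single j 1, Or.inr ?_, rfl⟩
    rw [Set.mem_ofPred_eq, emb_single]
    simp
  · rw [monoIdeal, Ideal.span_le]
    rintro _ ⟨u, hu | hu, rfl⟩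
    · exact Submodule.mem_sup_left (Ideal.subset_span ⟨u, hu, rfl⟩)
    · rw [Set.mem_ofPred_eq, emb_apply] at hu
      refine Submodule.mem_sup_right (Ideal.mem_span_singleton.2 ?_)
      rw [X, monomial_dvd_monomial]
      refine ⟨Or.inr ?_, one_dvd _⟩
      rw [Finsupp.single_le_iff]
      omega

/-- The monomial of w is a socle element: every monomial occurring in a product with an element
without constant term is a proper multiple of it. -/
theorem not_noSocle_monoIdeal (hup : IsUpperSet S) {w : ℕ →₀ ℕ} (hw : ∀ j, n ≤ j → w j = 0)
    (hwS : w ∉ S) (h : ∀ i < n, w + Finsupp.single i 1 ∈ S) :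
    ¬ NoSocle (irrelevant K n) (monoIdeal K n S) := by
  obtain ⟨u, rfl⟩ := exists_emb_eq hw
  intro hns
  obtain ⟨a, ha, hau⟩ := hns (monomial u 1) (mt (monomial_mem_monoIdeal hup).1 hwS)
  apply hau
  rw [mem_monoIdeal hup]
  intro v hv
  rw [mem_support_iff] at hv
  have hle : u ≤ v := by
    by_contra hle
    rw [coeff_mul_monomial', if_neg hle] at hv
    exact hv rfl
  rw [coeff_mul_monomial', if_pos hle, mul_one] at hv
  have hne : v - u ≠ 0 := by
    intro h0
    rw [h0] at hv
    rw [mem_irrelevant, constantCoeff_eq] at ha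
    exact hv ha
  obtain ⟨i, hi⟩ := Finsupp.ne_iff.1 hne
  refine hup ?_ (h i i.2)
  rw [← emb_single, ← emb_add, emb_le_emb, ← add_tsub_cancel_of_le hle]
  refine add_le_add_right ?_ u
  rw [Finsupp.single_le_iff]
  exact Nat.one_le_iff_ne_zero.2 hi

theorem finrank_supported (F : Finset (ℕ →₀ ℕ)) (hF : ∀ w ∈ F, ∀ j, n ≤ j → w j = 0)
    (V : Submodule K (MvPolynomial (Fin n) K))
    (hV : ∀ f, f ∈ V ↔ ∀ u ∈ f.support, emb u ∈ F) : Module.finrank K V = F.card := by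
  classical
  choose! g hg using fun w (hw : w ∈ F) => exists_emb_eq (hF w hw)
  have hinj : Function.Injective fun w : F => g w := by
    intro a b hab
    have := congrArg emb hab
    simp only [hg _ a.2, hg _ b.2] at this
    exact Subtype.ext this
  have hli : LinearIndependent K fun w : F => monomial (g w) (1 : K) := by
    have := (basisMonomials (Fin n) K).linearIndependent.comp _ hinj
    rwa [coe_basisMonomials] at this
  have hspan : Submodule.span K (Set.range fun w : F => monomial (g w) (1 : K)) = V := by
    apply le_antisymm
    · rw [Submodule.span_le]
      rintro _ ⟨w, rfl⟩
      refine (hV _).2 fun u hu => ?_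
      rw [support_monomial, if_neg one_ne_zero, Finset.mem_singleton] at hu
      rw [hu, hg _ w.2]
      exact w.2
    · intro f hf
      rw [f.as_sum]
      refine Submodule.sum_mem _ fun u hu => ?_
      have huF := (hV f).1 hf u hu
      rw [show monomial u (coeff u f) = coeff u f • monomial u (1 : K) by
        rw [smul_monomial, smul_eq_mul, mul_one]]
      refine Submodule.smul_mem _ _ (Submodule.subset_span ⟨⟨emb u, huF⟩, ?_⟩)
      simp only [show g (emb u) = u from emb_injective (hg _ huF)]
  rw [← hspan, finrank_span_eq_card hli, Fintype.card_coe]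

theorem hilbertFunction_monoIdeal (hup : IsUpperSet S) (q : ℕ) :
    hilbertFunction (monoIdeal K n S) q = standardCount S n q := by
  classical
  have h0 : ∀ f : MvPolynomial (Fin n) K,
      f ∈ homogeneousSubmodule (Fin n) K q ↔ ∀ u ∈ f.support, emb u ∈ mons n q := by
    intro f
    rw [mem_homogeneousSubmodule]
    constructor
    · intro hf u hu
      rw [mem_mons, degree_emb]
      refine ⟨?_, fun j hj => emb_of_le u hj⟩
      have := hf (mem_support_iff.1 hu)
      rwa [Finsupp.degree_eq_weight_one]
    · intro hf u hu
      have := (mem_mons.1 (hf u (mem_support_iff.2 hu))).1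
      rwa [degree_emb, Finsupp.degree_eq_weight_one] at this
  rw [hilbertFunction_eq_codim, codim,
    finrank_supported (mons n q) (fun w hw => (mem_mons.1 hw).2) _ h0,
    finrank_supported ((mons n q).filter fun u => u ∈ S)
      (fun w hw => (mem_mons.1 (Finset.mem_filter.1 hw).1).2)]
  · have := Finset.card_filter_add_card_filter_not (s := mons n q) (fun u => u ∈ S)
    rw [standardCount, ← this, Nat.add_sub_cancel_left]
  · intro f
    rw [mem_idealPiece, mem_monoIdeal hup, h0]
    simp only [Finset.mem_filter]
    exact ⟨fun h u hu => ⟨h.2 u hu, h.1 u hu⟩, fun h => ⟨fun u hu => (h u hu).2, fun u hu => (h u hu).1⟩⟩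

end MonomialIdeals

/-! ### Partial sums and the dichotomy for lexsegments -/

section LexCounting

/-- The function `q ↦ G 0 + ⋯ + G q`. -/
def partialSum (G : ℕ → ℕ) (q : ℕ) : ℕ := ∑ i ∈ Finset.range (q + 1), G i

theorem eq_partialSum {F G : ℕ → ℕ} (h0 : F 0 = G 0) (h : ∀ q, F (q + 1) = G (q + 1) + F q) :
    F = partialSum G := by
  funext q
  induction q with
  | zero => simp [partialSum, h0]
  | succ q ih => rw [h, ih, partialSum, partialSum, Finset.sum_range_succ _ (q + 1), add_comm]

theorem DeterminedBelow.mono {S : Set (ℕ →₀ ℕ)} (hup : IsUpperSet S) {m k : ℕ}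
    (hdet : DeterminedBelow m S) (h : m ≤ k) : DeterminedBelow k S := by
  have hle : ∀ w : ℕ →₀ ℕ, w.filter (· < k) ≤ w := by
    intro w j
    rw [Finsupp.filter_apply]
    split_ifs <;> simp
  intro u
  refine ⟨fun hu => ?_, fun hu => hup (hle u) hu⟩
  refine hup ?_ ((hdet u).1 hu)
  intro j
  rw [Finsupp.filter_apply, Finsupp.filter_apply]
  split_ifs
  · exact le_rfl
  · omega
  · simp
  · simp

theorem DeterminedBelow.mem_of_add_single_mem {S : Set (ℕ →₀ ℕ)} {m j : ℕ}
    (hdet : DeterminedBelow m S) (hj : m ≤ j) {w : ℕ →₀ ℕ} (hw : w + Finsupp.single j 1 ∈ S) :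
    w ∈ S := by
  rw [hdet, Finsupp.filter_add, Finsupp.filter_single_of_neg (fun x => x < m) (by omega),
    add_zero, ← hdet] at hw
  exact hw

theorem standardCount_add {S : Set (ℕ →₀ ℕ)} (hup : IsUpperSet S) (h0 : 0 ∉ S) {m : ℕ}
    (hdet : DeterminedBelow m S) (r : ℕ) :
    standardCount S (m + r) = partialSum^[r] (standardCount S m) := by
  induction r with
  | zero => rfl
  | succ r ih =>
    rw [Function.iterate_succ_apply', ← ih]
    refine eq_partialSum ?_ (standardCount_succ (hdet.mono hup (Nat.le_add_right m r)))
    rw [standardCount_zero_right h0, standardCount_zero_right h0]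

/-- If x_k is not regular, some w outside S has w x_k in S. The other products w x_i are
lexicographically larger, so they lie in S as well. With no variables, w = 0 is a socle element. -/
theorem LexBelow.determinedBelow_or_exists_socle {S : Set (ℕ →₀ ℕ)} {m : ℕ}
    (hlex : LexBelow m S) (hup : IsUpperSet S) (hdet : DeterminedBelow m S) (h0 : 0 ∉ S) :
    (∃ k, m = k + 1 ∧ DeterminedBelow k S) ∨
      ∃ w : ℕ →₀ ℕ, (∀ j, m ≤ j → w j = 0) ∧ w ∉ S ∧ ∀ i < m, w + Finsupp.single i 1 ∈ S := by
  rcases m with _ | k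
  · exact Or.inr ⟨0, fun _ _ => rfl, h0, fun i hi => absurd hi (by omega)⟩
  by_cases hreg : ∀ w : ℕ →₀ ℕ, (∀ j, k + 1 ≤ j → w j = 0) → w + Finsupp.single k 1 ∈ S → w ∈ S
  · exact Or.inl ⟨k, rfl, determinedBelow_of_regular hup hdet hreg⟩
  · push Not at hreg
    obtain ⟨w, hw, hwk, hwS⟩ := hreg
    refine Or.inr ⟨w, hw, hwS, fun i hi => ?_⟩
    rcases (Nat.lt_succ_iff.1 hi).eq_or_lt with rfl | hik
    · exact hwk
    · have hsupp : ∀ l ≤ k, ∀ j, k + 1 ≤ j → (w + Finsupp.single l 1 : ℕ →₀ ℕ) j = 0 := by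
        intro l hl j hj
        rw [Finsupp.add_apply, hw j hj, Finsupp.single_eq_of_ne (by omega), add_zero]
      exact hlex _ _ (hsupp k le_rfl) (hsupp i hik.le)
        (by rw [degree_add_single, degree_add_single]) hwk (single_lex_lt hik)

end LexCounting

/-! ### The set of depths -/

section Depths

variable {K : Type*} [Field K] {n : ℕ}

theorem isUpperSet_union_ne_zero {S : Set (ℕ →₀ ℕ)} (hup : IsUpperSet S) (m r : ℕ) :
    IsUpperSet (S ∪ {u | ∃ j, m ≤ j ∧ j < m + r ∧ u j ≠ 0}) := by
  refine hup.union ?_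
  rintro a b hab ⟨j, h1, h2, h3⟩
  have := hab j
  exact ⟨j, h1, h2, by omega⟩

/-- The variables x_m, …, x_{m+r-1} do not occur in S and are divided out successively; each is
regular modulo the preceding ones. -/
theorem depthGE_monoIdeal_iff {S : Set (ℕ →₀ ℕ)} (hup : IsUpperSet S) {m : ℕ}
    (hdet : DeterminedBelow m S) {r : ℕ} (hr : m + r ≤ n) (s : ℕ) :
    DepthGE (irrelevant K n) (r + s) (monoIdeal K n S) ↔
      DepthGE (irrelevant K n) s
        (monoIdeal K n (S ∪ {u | ∃ j, m ≤ j ∧ j < m + r ∧ u j ≠ 0})) := by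
  induction r generalizing s with
  | zero =>
    have : {u : ℕ →₀ ℕ | ∃ j, m ≤ j ∧ j < m + 0 ∧ u j ≠ 0} = ∅ := by
      ext u
      simp only [Set.mem_ofPred_eq, Set.mem_empty_iff_false, iff_false]
      rintro ⟨j, h1, h2, -⟩
      omega
    rw [this, Set.union_empty, zero_add]
  | succ r ih =>
    have hlt : m + r < n := by omega
    rw [show r + 1 + s = r + (s + 1) by omega, ih (by omega),
      depthGE_succ_iff (h := X ⟨m + r, hlt⟩), monoIdeal_sup_span_X, Set.union_assoc]
    · suffices h : {u : ℕ →₀ ℕ | ∃ j, m ≤ j ∧ j < m + r ∧ u j ≠ 0} ∪ {u | u (m + r) ≠ 0}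
          = {u | ∃ j, m ≤ j ∧ j < m + (r + 1) ∧ u j ≠ 0} by rw [h]
      ext u
      simp only [Set.mem_union, Set.mem_ofPred_eq]
      constructor
      · rintro (⟨j, h1, h2, h3⟩ | h)
        · exact ⟨j, h1, by omega, h3⟩
        · exact ⟨m + r, by omega, by omega, h⟩
      · rintro ⟨j, h1, h2, h3⟩
        rcases (show j ≤ m + r by omega).eq_or_lt with rfl | hj
        · exact Or.inr h3
        · exact Or.inl ⟨j, h1, hj, h3⟩
    · rw [mem_irrelevant, constantCoeff_X]
    · refine regularMod_X_monoIdeal (isUpperSet_union_ne_zero hup m r) ?_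
      rintro w (h | ⟨j, h1, h2, h3⟩)
      · exact Or.inl (hdet.mem_of_add_single_mem (by simp) h)
      · refine Or.inr ⟨j, h1, h2, ?_⟩
        rwa [Finsupp.add_apply, Finsupp.single_eq_of_ne (by simp; omega), add_zero] at h3

theorem quotientDepth_monoIdeal {S : Set (ℕ →₀ ℕ)} (hup : IsUpperSet S) (h0 : 0 ∉ S) {m r : ℕ}
    (hdet : DeterminedBelow m S) {w : ℕ →₀ ℕ} (hw : ∀ j, m ≤ j → w j = 0) (hwS : w ∉ S)
    (hsoc : ∀ i < m, w + Finsupp.single i 1 ∈ S) :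
    quotientDepth (monoIdeal K (m + r) S) = r := by
  rw [quotientDepth_eq_iff (monoIdeal_le_irrelevant h0)]
  refine ⟨(depthGE_monoIdeal_iff hup hdet le_rfl 0).2 trivial, fun h => ?_⟩
  refine not_noSocle_monoIdeal (n := m + r) (w := w) (isUpperSet_union_ne_zero hup m r)
    (fun j hj => hw j (by omega)) ?_ ?_ ((depthGE_monoIdeal_iff hup hdet le_rfl 1).1 h).noSocle
  · rintro (h | ⟨j, h1, -, h3⟩)
    · exact hwS h
    · exact h3 (hw j h1)
  · intro i hi
    by_cases him : i < m
    · exact Or.inl (hsoc i him)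
    · exact Or.inr ⟨i, by omega, hi, by simp⟩

/-- The ideal is the extension by r variables of the lexsegment for G. If that lexsegment ignored
its last variable, the extension would be universal lexsegment and the r-fold partial sum critical.
-/
theorem mem_depthSet_of_not_isCritical {m r : ℕ} {G : ℕ → ℕ} (hG : MacaulayConditions m G)
    (hc : ¬ IsCritical K (m + r) (partialSum^[r] G)) :
    r ∈ depthSet K (m + r) (partialSum^[r] G) := by
  obtain ⟨S, hup, hdet, hlex, hS⟩ := hG.exists_lexBelow
  have hSG : standardCount S m = G := funext hS
  have h0 : (0 : ℕ →₀ ℕ) ∉ S := by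
    classical
    intro h0
    have h1 := hS 0
    rw [hG.zero, standardCount, Finset.filter_false_of_mem] at h1
    · exact absurd h1 (by simp)
    · intro u hu
      rw [mem_mons, Finsupp.degree_eq_zero_iff] at hu
      rw [hu.1]
      exact not_not.2 h0
  have hH : hilbertFunction (monoIdeal K (m + r) S) = partialSum^[r] G := by
    rw [← hSG, ← standardCount_add hup h0 hdet]
    exact funext fun q => hilbertFunction_monoIdeal hup q
  rcases hlex.determinedBelow_or_exists_socle hup hdet h0 with ⟨k, rfl, hk⟩ | ⟨w, hw, hwS, hsoc⟩
  · have hall := hlex.lexAll hup hk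
    have huniv := (isUniversalLexsegment_monoIdeal_iff (K := K) hup
      (hdet.mono hup (Nat.le_add_right _ r))).2 hall
    exact absurd ⟨_, huniv.1, hH, huniv⟩ hc
  · exact ⟨by omega, _, isHomogeneousIdeal_monoIdeal, hH,
      quotientDepth_monoIdeal hup h0 hdet hw hwS hsoc⟩

theorem DepthGE.exists_hilbertFunction_succ [Infinite K] {I : Ideal (MvPolynomial (Fin n) K)}
    (hI : IsHomogeneousIdeal I) (hle : I ≤ irrelevant K n) {r : ℕ}
    (h : DepthGE (irrelevant K n) (r + 1) I) :
    ∃ J : Ideal (MvPolynomial (Fin n) K), IsHomogeneousIdeal J ∧ J ≤ irrelevant K n ∧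
      DepthGE (irrelevant K n) r J ∧
      ∀ q, hilbertFunction I (q + 1) = hilbertFunction J (q + 1) + hilbertFunction I q := by
  obtain ⟨c, hc⟩ := h.noSocle.exists_regularMod_linForm
  have hcm := linForm_mem_irrelevant c
  exact ⟨_, hI.sup_linForm c, sup_le hle ((Ideal.span_singleton_le_iff_mem _).2 hcm),
    (depthGE_succ_iff hcm hc).1 h, hilbertFunction_succ hI hc⟩

/-- The ideals obtained by cutting remain in the same polynomial ring. The number of variables is
tracked instead by the bound N on the Hilbert function in degree 1, which drops by one with each
regular linear form. -/
theorem DepthGE.exists_eq_partialSum [Infinite K] {I : Ideal (MvPolynomial (Fin n) K)}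
    (hI : IsHomogeneousIdeal I) (hle : I ≤ irrelevant K n) {r N : ℕ}
    (h : DepthGE (irrelevant K n) r I) (hN : hilbertFunction I 1 ≤ N) :
    ∃ m G, N = m + r ∧ MacaulayConditions m G ∧ hilbertFunction I = partialSum^[r] G := by
  induction r generalizing I N with
  | zero =>
    exact ⟨N, hilbertFunction I, rfl, ⟨hilbertFunction_zero hle, hN,
      fun q hq => hilbertFunction_succ_le I hq⟩, rfl⟩
  | succ r ih =>
    obtain ⟨J, hJ, hJle, hJr, hsum⟩ := h.exists_hilbertFunction_succ hI hle
    have h1 := hsum 0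
    rw [hilbertFunction_zero hle, zero_add] at h1
    obtain ⟨m, G, hm, hG, hJG⟩ := ih hJ hJle hJr (N := N - 1) (by omega)
    refine ⟨m, G, by omega, hG, ?_⟩
    rw [Function.iterate_succ_apply', ← hJG]
    exact eq_partialSum (by rw [hilbertFunction_zero hle, hilbertFunction_zero hJle]) hsum

/-- All homogeneous ideals whose Hilbert function is that of a universal lexsegment ideal have
the same depth. -/
theorem LexAll.exists_depthGE_iff (K : Type*) [Field K] [Infinite K] (n : ℕ) {S : Set (ℕ →₀ ℕ)}
    (hlex : LexAll S) (hup : IsUpperSet S) (h0 : 0 ∉ S) {m : ℕ} (hdet : DeterminedBelow m S) :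
    ∃ t ≤ m, ∀ I : Ideal (MvPolynomial (Fin n) K), IsHomogeneousIdeal I → I ≤ irrelevant K n →
      (∀ q, hilbertFunction I q = standardCount S m q) →
      ∀ r, DepthGE (irrelevant K n) r I ↔ r ≤ t := by
  induction m with
  | zero =>
    refine ⟨0, le_rfl, fun I hI hle hIS r => ?_⟩
    rcases r with _ | r
    · simp [DepthGE]
    · refine iff_of_false (fun h => ?_) (by omega)
      obtain ⟨J, -, -, -, hsum⟩ := h.exists_hilbertFunction_succ hI hle
      have h1 := hsum 0
      rw [hIS, hilbertFunction_zero hle, standardCount, show mons 0 (0 + 1) = ∅ by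
        refine Finset.eq_empty_of_forall_notMem fun u hu => ?_
        rw [mem_mons] at hu
        have : u = 0 := Finsupp.ext fun j => hu.2 j (Nat.zero_le j)
        rw [this] at hu
        simp at hu] at h1
      simp at h1
  | succ k ih =>
    by_cases hk : DeterminedBelow k S
    · obtain ⟨t, htk, ht⟩ := ih hk
      refine ⟨t + 1, by omega, fun I hI hle hIS r => ?_⟩
      rcases r with _ | r
      · simp [DepthGE]
      -- The last variable is regular modulo S, so the common Hilbert function meets Green's bound.
      -- This forces a regular linear form on every such I, and the quotient has the counting
      -- function in k variables.
      obtain ⟨c, hc⟩ := (noSocle_of_greenPow_add_le hI fun q => by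
        rw [hIS, hIS]
        exact (hlex.lexBelow (k + 1)).greenPow_add_le
          (fun w _ hw => hk.mem_of_add_single_mem le_rfl hw) q).exists_regularMod_linForm
      have hcm := linForm_mem_irrelevant c
      have hJle : I ⊔ Ideal.span {linForm c} ≤ irrelevant K n :=
        sup_le hle ((Ideal.span_singleton_le_iff_mem _).2 hcm)
      rw [depthGE_succ_iff hcm hc, ht _ (hI.sup_linForm c) hJle, Nat.add_le_add_iff_right]
      rintro (_ | q)
      · rw [hilbertFunction_zero hJle, standardCount_zero_right h0]
      · have h1 := hilbertFunction_succ hI hc q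
        rw [hIS, hIS, standardCount_succ hk] at h1
        omega
    · refine ⟨0, Nat.zero_le _, fun I hI hle hIS r => ?_⟩
      rcases r with _ | r
      · simp [DepthGE]
      refine iff_of_false (fun h => ?_) (by omega)
      obtain ⟨J, -, -, -, hsum⟩ := h.exists_hilbertFunction_succ hI hle
      -- Positive depth would make the counting function a sum transform, which is impossible as
      -- soon as x_k is a zero divisor modulo S.
      refine hk (determinedBelow_of_regular hup hdet fun w hw hwk => ?_)
      by_contra hwS
      refine hlex.not_sum_transform hdet hw hwS hwk (G := hilbertFunction J)
        (fun q hq => hilbertFunction_succ_le J hq) fun q => ?_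
      rw [← hIS, ← hIS, hsum]

/-- Only the fact that H is an s-fold partial sum is extracted over the algebraic closure. The ideal
of depth s is then built from a lexsegment over K itself. -/
theorem mem_depthSet_of_le {H : ℕ → ℕ} (hH : MacaulayConditions n H) (hc : ¬ IsCritical K n H)
    {r s : ℕ} (hr : r ∈ depthSet K n H) (hs : s ≤ r) : s ∈ depthSet K n H := by
  obtain ⟨-, I, hI, hIH, hIr⟩ := hr
  have hle : I ≤ irrelevant K n := hI.le_irrelevant (by rw [hIH, hH.zero]; exact one_ne_zero)
  have hdepth := ((quotientDepth_eq_iff hle r).1 hIr).1.mono hs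
  rw [← depthGE_extend_iff (L := AlgebraicClosure K)] at hdepth
  obtain ⟨m, G, rfl, hG, hIG⟩ := hdepth.exists_eq_partialSum hI.extend (extend_le_irrelevant hle)
    (N := n) (by rw [hilbertFunction_extend, hIH]; exact hH.one)
  rw [hilbertFunction_extend, hIH] at hIG
  subst hIG
  exact mem_depthSet_of_not_isCritical hG hc

theorem exists_depthSet_eq_of_not_isCritical {H : ℕ → ℕ} (hH : MacaulayConditions n H)
    (hc : ¬ IsCritical K n H) :
    ∃ b : ℕ, IsGreatest (depthSet K n H) b ∧ depthSet K n H = {r | r ≤ b} := by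
  have h0 : 0 ∈ depthSet K n H := mem_depthSet_of_not_isCritical (r := 0) hH hc
  have hbdd : BddAbove (depthSet K n H) := ⟨n, fun r hr => hr.1⟩
  have hb := Nat.sSup_mem ⟨0, h0⟩ hbdd
  refine ⟨_, ⟨hb, fun r hr => le_csSup hbdd hr⟩, ?_⟩
  ext r
  exact ⟨fun hr => le_csSup hbdd hr, fun hr => mem_depthSet_of_le hH hc hb hr⟩

theorem exists_depthSet_eq_singleton {H : ℕ → ℕ} (hH : MacaulayConditions n H)
    (hc : IsCritical K n H) : ∃ t, depthSet K n H = {t} := by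
  obtain ⟨I, hI, hIH, huniv⟩ := hc
  obtain ⟨S, hup, hdet, rfl⟩ := hI.1.exists_eq_monoIdeal
  have hlex := (isUniversalLexsegment_monoIdeal_iff hup hdet).1 huniv
  have hirr : ∀ J : Ideal (MvPolynomial (Fin n) K), IsHomogeneousIdeal J →
      hilbertFunction J = H → J ≤ irrelevant K n := fun J hJ hJH =>
    hJ.le_irrelevant (by rw [hJH, hH.zero]; exact one_ne_zero)
  have h0 : (0 : ℕ →₀ ℕ) ∉ S := by
    intro h0
    have h1 := hirr _ isHomogeneousIdeal_monoIdeal hIH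
      ((monomial_mem_monoIdeal (u := 0) hup).2 (by simpa [emb] using h0))
    rw [mem_irrelevant, constantCoeff_monomial, if_pos rfl] at h1
    exact one_ne_zero h1
  obtain ⟨t, htn, ht⟩ := hlex.exists_depthGE_iff (AlgebraicClosure K) n hup h0 hdet
  have key : ∀ J : Ideal (MvPolynomial (Fin n) K), IsHomogeneousIdeal J →
      hilbertFunction J = H → quotientDepth J = t := by
    intro J hJ hJH
    have hle := hirr J hJ hJH
    have h1 := ht _ (hJ.extend (L := AlgebraicClosure K)) (extend_le_irrelevant hle)
      (fun q => by rw [hilbertFunction_extend, hJH, ← hIH, hilbertFunction_monoIdeal hup])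
    simp only [depthGE_extend_iff] at h1
    rw [quotientDepth_eq_iff hle, h1, h1]
    omega
  refine ⟨t, Set.Subset.antisymm ?_ ?_⟩
  · rintro r ⟨-, J, hJ, hJH, hJr⟩
    rw [key J hJ hJH] at hJr
    exact_mod_cast hJr.symm
  · rintro _ rfl
    exact ⟨htn, _, isHomogeneousIdeal_monoIdeal, hIH, key _ isHomogeneousIdeal_monoIdeal hIH⟩

end Depths

theorem theorem2p1 {K : Type*} [Field K] (n : ℕ) (H : ℕ → ℕ) (hH : MacaulayConditions n H) :
    (¬ IsCritical K n H →
      ∃ b : ℕ, IsGreatest (depthSet K n H) b ∧ depthSet K n H = {r | r ≤ b}) ∧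
    ((∃ b : ℕ, b ≤ n ∧ depthSet K n H = {r | r ≤ b}) ∨ (depthSet K n H).ncard = 1) := by
  refine ⟨exists_depthSet_eq_of_not_isCritical hH, ?_⟩
  by_cases hc : IsCritical K n H
  · obtain ⟨t, ht⟩ := exists_depthSet_eq_singleton hH hc
    exact Or.inr (by rw [ht, Set.ncard_singleton])
  · obtain ⟨b, hb, hset⟩ := exists_depthSet_eq_of_not_isCritical hH hc
    exact Or.inl ⟨b, hb.1.1, hset⟩
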